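/- Let $n,k\ge 1$ be integers, let $B^n\subset\mathbb R^n$ be the open unit ball and $\mathbb S^n\subset\mathbb R^{n+1}$ the unit sphere, and let $$W^{k,2}(B^n,\mathbb S^n)=\{u\in W^{k,2}(B^n,\mathbb R^{n+1}) : u(x)\in\mathbb S^n \text{ for a.e. } x\}.$$ For $u\in W^{k,2}(B^n,\mathbb S^n)$ the extrinsic $k$-energy is $$E_k^{\rm ext}(u)=\int_{B^n}|\Delta^s u|^2\,dx\ \text{ if } k=2s,\qquad E_k^{\rm ext}(u)=\int_{B^n}|\nabla\Delta^s u|^2\,dx\ \text{ if } k=2s+1,$$ with derivatives in the weak sense. A map $u\in W^{k,2}(B^n,\mathbb S^n)$ is called (weakly) extrinsic $k$-harmonic if for every $\phi\in C_c^\infty(B^n,\mathbb R^{n+1})$ the maps $u_t=\Pi(u+t\phi)$, where $\Pi(y)=y/|y|$ is the nearest point projection onto $\mathbb S^n$, lie in $W^{k,2}(B^n,\mathbb S^n)$ for all $t$ near $0$ and $$\frac{d}{dt}E_k^{\rm ext}(u_t)\Big|_{t=0}=0,$$ the derivative being part of the assertion to exist. **Proposition.** The equator map $u^*:B^n\to\mathbb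 S^n$, $u^*(x)=(x/|x|,0)$ (defined for $x \neq 0$), belongs to $W^{k,2}(B^n,\mathbb S^n)$ if and only if $n\ge 2k+1$. Moreover, if $n\ge 2k+1$, then $u^*$ is a (weakly) extrinsic $k$-harmonic map. -/

import Mathlib

open MeasureTheory Topology TopologicalSpace
open scoped Distributions

noncomputable section

namespace EquatorMap

/-- Euclidean space `ℝⁿ`. -/
abbrev Euc (n : ℕ) : Type := EuclideanSpace ℝ (Fin n)

/-- The open Euclidean unit ball `Bⁿ ⊂ ℝⁿ`. -/
def unitBall (n : ℕ) : Opens (Euc n) := ⟨Metric.ball 0 1, Metric.isOpen_ball⟩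

section Weak

variable {n : ℕ} {F : Type*} [NormedAddCommGroup F] [NormedSpace ℝ F]

/-- `g` is the weak derivative `∂_{α 0} ⋯ ∂_{α (m-1)} u` on `Ω`: both functions are locally
integrable on `Ω` and `∫_Ω (∂^α φ) u = (-1)^m ∫_Ω φ g` for every test function
`φ ∈ C_c^∞(Ω, ℝ)`. -/
def HasWeakDeriv (Ω : Opens (Euc n)) {m : ℕ} (α : Fin m → Fin n) (u g : Euc n → F) : Prop :=
  LocallyIntegrableOn u (Ω : Set (Euc n)) volume ∧
  LocallyIntegrableOn g (Ω : Set (Euc n)) volume ∧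
  ∀ φ : 𝓓(Ω, ℝ),
    ∫ x in (Ω : Set (Euc n)),
        (iteratedFDeriv ℝ m φ x fun j => EuclideanSpace.single (α j) (1 : ℝ)) • u x
      = (-1 : ℝ) ^ m • ∫ x in (Ω : Set (Euc n)), φ x • g x

/-- The Sobolev space `W^{k,2}(Ω, F)`: `u` is in `L²(Ω)`, and all its weak derivatives of order
at most `k` exist and are in `L²(Ω)`. -/
def MemSobolev (Ω : Opens (Euc n)) (k : ℕ) (u : Euc n → F) : Prop :=
  MemLp u 2 (volume.restrict (Ω : Set (Euc n))) ∧
  ∀ m ≤ k, ∀ α : Fin m → Fin n, ∃ g : Euc n → F,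
    HasWeakDeriv Ω α u g ∧ MemLp g 2 (volume.restrict (Ω : Set (Euc n)))

open Classical in
/-- The weak partial derivative `∂_i u` on `Ω`, unique up to null sets when it exists
(and `0` by convention if it does not). -/
def weakPartial (Ω : Opens (Euc n)) (i : Fin n) (u : Euc n → F) : Euc n → F :=
  if h : ∃ g, HasWeakDeriv Ω (fun _ : Fin 1 => i) u g then h.choose else 0

/-- The weak Laplacian `Δ u = ∑ i, ∂_i ∂_i u`. -/
def weakLaplacian (Ω : Opens (Euc n)) (u : Euc n → F) : Euc n → F :=
  fun x => ∑ i, weakPartial Ω i (weakPartial Ω i u) x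

/-- The extrinsic `k`-energy: `∫_Ω |Δ^s u|²` if `k = 2s`, and `∫_Ω |∇ Δ^s u|²` if `k = 2s+1`. -/
def extrinsicEnergy (Ω : Opens (Euc n)) (k : ℕ) (u : Euc n → F) : ℝ :=
  if Even k then
    ∫ x in (Ω : Set (Euc n)), ‖((weakLaplacian Ω)^[k / 2] u) x‖ ^ 2
  else
    ∫ x in (Ω : Set (Euc n)), ∑ i, ‖weakPartial Ω i ((weakLaplacian Ω)^[k / 2] u) x‖ ^ 2

end Weak

/-- `W^{k,2}(Bⁿ, 𝕊ⁿ)`: the maps of `W^{k,2}(Bⁿ, ℝⁿ⁺¹)` with values in the unit sphere a.e. -/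
def MemSobolevSphere (n k : ℕ) (u : Euc n → Euc (n + 1)) : Prop :=
  MemSobolev (unitBall n) k u ∧
  ∀ᵐ x ∂volume.restrict (unitBall n : Set (Euc n)), u x ∈ Metric.sphere (0 : Euc (n + 1)) 1

/-- The nearest point projection `Π(y) = y / |y|` onto the unit sphere, defined for `y ≠ 0`
(see `sphereProj_mem` and `dist_sphereProj_le`). -/
def sphereProj {N : ℕ} (y : Euc N) : Euc N := ‖y‖⁻¹ • y

theorem sphereProj_mem {N : ℕ} {y : Euc N} (hy : y ≠ 0) :
    sphereProj y ∈ Metric.sphere (0 : Euc N) 1 := by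
  simp [sphereProj, norm_smul, hy]

theorem dist_sphereProj_le {N : ℕ} {y : Euc N} (hy : y ≠ 0) {z : Euc N}
    (hz : z ∈ Metric.sphere (0 : Euc N) 1) : dist y (sphereProj y) ≤ dist y z := by
  have hy' : ‖y‖ ≠ 0 := norm_ne_zero_iff.mpr hy
  have h1 : y - sphereProj y = (1 - ‖y‖⁻¹) • y := by simp [sphereProj, sub_smul]
  have h2 : ‖y - sphereProj y‖ = |‖y‖ - 1| := by
    rw [h1, norm_smul, Real.norm_eq_abs]
    nth_rewrite 2 [← abs_norm y]
    rw [← abs_mul, sub_mul, inv_mul_cancel₀ hy', one_mul]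
  have h3 : ‖z‖ = 1 := by simpa using hz
  rw [dist_eq_norm, dist_eq_norm, h2, ← h3]
  exact abs_norm_sub_norm_le y z

/-- The variation `u_t = Π(u + t φ)`. -/
def variation {n : ℕ} (u φ : Euc n → Euc (n + 1)) (t : ℝ) : Euc n → Euc (n + 1) :=
  fun x => sphereProj (u x + t • φ x)

/-- `u` is an extrinsic (weakly) `k`-harmonic map `Bⁿ → 𝕊ⁿ`: it is in `W^{k,2}(Bⁿ, 𝕊ⁿ)`, and for
every `φ ∈ C_c^∞(Bⁿ, ℝⁿ⁺¹)` the variation `u_t = Π(u + t φ)` is admissible for small `t` and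
`d/dt E_k(u_t)` exists at `t = 0` and is `0`. -/
def IsExtrinsicHarmonic (n k : ℕ) (u : Euc n → Euc (n + 1)) : Prop :=
  MemSobolevSphere n k u ∧
  ∀ φ : 𝓓(unitBall n, Euc (n + 1)),
    (∀ᶠ t : ℝ in 𝓝 0, MemSobolevSphere n k (variation u φ t)) ∧
    HasDerivAt (fun t : ℝ => extrinsicEnergy (unitBall n) k (variation u φ t)) 0 0

/-- The equator map `u*(x) = (x / |x|, 0)` (its value at the single point `x = 0` is
immaterial). -/
def equatorMap (n : ℕ) : Euc n → Euc (n + 1) :=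
  fun x => WithLp.toLp 2 (Fin.snoc (α := fun _ => ℝ) (fun i => x i / ‖x‖) 0)

end EquatorMap

end

/-! Everything about the singularity at the origin is encoded by `SingClass N a`: on the punctured
ball the function is `O(|x|⁻ᵃ)` and each of `N` derivatives costs one more power of `|x|`. Exponents
add under products, and `u* = |x|⁻¹ (x, 0)` has class `0` to every order. A function of class `a` is
integrable on the ball if `a < n` and square integrable if `2a < n`. Cutting out a shrinking
neighbourhood of `0` shows that classical derivatives are weak derivatives as long as the
differentiated function still has class below `n` (`integral_partialDeriv_eq_zero`,
`exists_hasWeakDeriv`). Hence `u* ∈ W^{k,2}` when `2k < n`. The class is stated for families with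
uniform constants so that it can control a remainder depending on `t`.

Harmonicity: on the punctured ball `Π(u* + tφ) = u* + tψ + t² R_t`, where `ψ` is the part of `φ`
tangential to the sphere and `R_t` has class `0` uniformly in small `t`
(`exists_variation_expansion`). So the energy is differentiable at `0`, and by Green's formula its
derivative is, up to sign, `2 ∫ ⟨Δᵏ u*, ψ⟩`. Since `Δ(|x|ᵖ x) = p(p+n) |x|ᵖ⁻² x`, the vector `Δᵏ u*`
is pointwise parallel to `u*`, hence orthogonal to `ψ`.

Necessity: let `n ≤ 2k` and suppose that `∂ᵢᵏ u* = g` weakly on the ball with `g ∈ L²`. Testing with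
`φ(l·)`, the homogeneity of `u*` and Cauchy–Schwarz bound `|∫ (∂ᵢᵏ φ) u*|` by a constant times
`l^{n/2-k}` times the `L²` norm of `g` on a ball of radius `r/l`, which tends to `0` as `l → ∞`. So
`∂ᵢᵏ u* = 0` as a distribution on all of `ℝⁿ` (`integral_dirDeriv_iterate_smul_equatorMap_eq_zero`).
This is impossible: mollifications of the bounded map `u*` would be constant along lines in
direction `eᵢ`, whereas they tend to opposite nonzero limits at the two ends
(`exists_equatorConv_dirDeriv_iterate_ne_zero`). -/

noncomputable section

namespace EquatorMap

/-! ### Calculus of functions with a power singularity at the origin -/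

section SingularClass

set_option linter.unusedSectionVars false

variable {n : ℕ} {σ τ F G H : Type*}
  [NormedAddCommGroup F] [NormedSpace ℝ F] [NormedAddCommGroup G] [NormedSpace ℝ G]
  [NormedAddCommGroup H] [NormedSpace ℝ H]

/-- The unit ball of `ℝⁿ` without its centre. -/
def puncturedBall (n : ℕ) : Set (Euc n) := Metric.ball 0 1 \ {0}

/-- The `i`-th standard unit vector. -/
abbrev stdVec (i : Fin n) : Euc n := EuclideanSpace.single i (1 : ℝ)

/-- The classical partial derivative `∂_i f`. -/
def partialDeriv (i : Fin n) (f : Euc n → F) : Euc n → F := fun x => lineDeriv ℝ f x (stdVec i)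

/-- The classical Laplacian. -/
def laplacian (f : Euc n → F) : Euc n → F := fun x => ∑ i, partialDeriv i (partialDeriv i f) x

/-- The family `f` is continuous on the punctured ball and `O(|x|⁻ᵃ)` uniformly. -/
def SingBound (a : ℤ) (f : τ → Euc n → F) : Prop :=
  (∀ t, ContinuousOn (f t) (puncturedBall n)) ∧
    ∃ C : ℝ, ∀ t, ∀ x ∈ puncturedBall n, ‖f t x‖ ≤ C * ‖x‖ ^ (-a)

/-- The family `f` has `N` derivatives on the punctured ball, and its derivatives of order `m` are
`O(|x|⁻ᵃ⁻ᵐ)` uniformly. -/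
def SingClass : ℕ → ℤ → (τ → Euc n → F) → Prop
  | 0, a, f => SingBound a f
  | N + 1, a, f => SingBound a f ∧ ∀ i : Fin n, ∃ g : τ → Euc n → F,
      (∀ t, ∀ x ∈ puncturedBall n, HasLineDerivAt ℝ (f t) (g t x) x (stdVec i)) ∧
        SingClass N (a + 1) g

theorem isOpen_puncturedBall : IsOpen (puncturedBall n) :=
  Metric.isOpen_ball.sdiff isClosed_singleton

theorem mem_puncturedBall {x : Euc n} : x ∈ puncturedBall n ↔ ‖x‖ < 1 ∧ x ≠ 0 := by
  simp [puncturedBall]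

theorem SingClass.singBound {N : ℕ} {a : ℤ} {f : τ → Euc n → F} (h : SingClass N a f) :
    SingBound a f := by
  cases N with
  | zero => exact h
  | succ N => exact h.1

theorem SingClass.of_succ {N : ℕ} {a : ℤ} {f : τ → Euc n → F} (h : SingClass (N + 1) a f) :
    SingClass N a f := by
  induction N generalizing a f with
  | zero => exact h.1
  | succ N ih =>
    refine ⟨h.1, fun i => ?_⟩
    obtain ⟨g, hg, hg'⟩ := h.2 i
    exact ⟨g, hg, ih hg'⟩

theorem SingClass.mono {M N : ℕ} {a : ℤ} {f : τ → Euc n → F} (h : SingClass N a f) (hMN : M ≤ N) :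
    SingClass M a f := by
  induction N, hMN using Nat.le_induction with
  | base => exact h
  | succ N _ ih => exact ih h.of_succ

theorem SingBound.congr {a : ℤ} {f g : τ → Euc n → F} (h : SingBound a f)
    (hfg : ∀ t, ∀ x ∈ puncturedBall n, g t x = f t x) : SingBound a g := by
  refine ⟨fun t => (h.1 t).congr (hfg t), ?_⟩
  obtain ⟨C, hC⟩ := h.2
  exact ⟨C, fun t x hx => by rw [hfg t x hx]; exact hC t x hx⟩

theorem hasLineDerivAt_congr_puncturedBall {f g : Euc n → F} {f' : F} {x v : Euc n}
    (hx : x ∈ puncturedBall n) (h : HasLineDerivAt ℝ f f' x v)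
    (hfg : ∀ x ∈ puncturedBall n, g x = f x) : HasLineDerivAt ℝ g f' x v :=
  h.congr_of_eventuallyEq (Filter.eventually_of_mem (isOpen_puncturedBall.mem_nhds hx) hfg)

theorem SingClass.congr {N : ℕ} {a : ℤ} {f g : τ → Euc n → F} (h : SingClass N a f)
    (hfg : ∀ t, ∀ x ∈ puncturedBall n, g t x = f t x) : SingClass N a g := by
  cases N with
  | zero => exact SingBound.congr h hfg
  | succ N =>
    refine ⟨h.1.congr hfg, fun i => ?_⟩
    obtain ⟨f', hf, hf'⟩ := h.2 i
    exact ⟨f', fun t x hx => hasLineDerivAt_congr_puncturedBall hx (hf t x hx) (hfg t), hf'⟩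

theorem SingClass.reindex {N : ℕ} {a : ℤ} {f : τ → Euc n → F} (h : SingClass N a f) (c : σ → τ) :
    SingClass N a fun s => f (c s) := by
  induction N generalizing a f with
  | zero => exact ⟨fun s => h.1 _, h.2.imp fun C hC s => hC _⟩
  | succ N ih =>
    refine ⟨⟨fun s => h.1.1 _, h.1.2.imp fun C hC s => hC _⟩, fun i => ?_⟩
    obtain ⟨f', hf, hf'⟩ := h.2 i
    exact ⟨fun s => f' (c s), fun s => hf _, ih hf'⟩

theorem SingClass.hasLineDerivAt {N : ℕ} {a : ℤ} {f : τ → Euc n → F} (h : SingClass (N + 1) a f)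
    (i : Fin n) (t : τ) {x : Euc n} (hx : x ∈ puncturedBall n) :
    HasLineDerivAt ℝ (f t) (partialDeriv i (f t) x) x (stdVec i) := by
  obtain ⟨f', hf, -⟩ := h.2 i
  rw [partialDeriv, (hf t x hx).lineDeriv]
  exact hf t x hx

theorem SingClass.partialDeriv {N : ℕ} {a : ℤ} {f : τ → Euc n → F} (h : SingClass (N + 1) a f)
    (i : Fin n) : SingClass N (a + 1) fun t => partialDeriv i (f t) := by
  obtain ⟨f', hf, hf'⟩ := h.2 i
  exact hf'.congr fun t x hx => (hf t x hx).lineDeriv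

theorem SingBound.add {a : ℤ} {f g : τ → Euc n → F} (hf : SingBound a f) (hg : SingBound a g) :
    SingBound a fun t x => f t x + g t x := by
  obtain ⟨hf, C, hC⟩ := hf
  obtain ⟨hg, D, hD⟩ := hg
  refine ⟨fun t => (hf t).add (hg t), C + D, fun t x hx => ?_⟩
  rw [add_mul]
  exact norm_add_le_of_le (hC t x hx) (hD t x hx)

theorem SingClass.add {N : ℕ} {a : ℤ} {f g : τ → Euc n → F} (hf : SingClass N a f)
    (hg : SingClass N a g) : SingClass N a fun t x => f t x + g t x := by
  induction N generalizing a f g with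
  | zero => exact SingBound.add hf hg
  | succ N ih =>
    refine ⟨hf.1.add hg.1, fun i => ?_⟩
    obtain ⟨f', hf1, hf2⟩ := hf.2 i
    obtain ⟨g', hg1, hg2⟩ := hg.2 i
    exact ⟨_, fun t x hx => HasDerivAt.add (hf1 t x hx) (hg1 t x hx), ih hf2 hg2⟩

theorem zpow_norm_add {x : Euc n} (hx : x ∈ puncturedBall n) (a b : ℤ) :
    ‖x‖ ^ (-(a + b)) = ‖x‖ ^ (-a) * ‖x‖ ^ (-b) := by
  rw [← zpow_add₀ (norm_ne_zero_iff.mpr (mem_puncturedBall.mp hx).2), neg_add]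

theorem SingBound.bilin (L : F →L[ℝ] G →L[ℝ] H) {a b : ℤ} {f : τ → Euc n → F} {g : τ → Euc n → G}
    (hf : SingBound a f) (hg : SingBound b g) : SingBound (a + b) fun t x => L (f t x) (g t x) := by
  obtain ⟨hf, C, hC⟩ := hf
  obtain ⟨hg, D, hD⟩ := hg
  refine ⟨fun t => ?_, ‖L‖ * (C * D), fun t x hx => ?_⟩
  · exact (L.continuous.comp_continuousOn (hf t)).clm_apply (hg t)
  · rw [zpow_norm_add hx]
    have h1 := hC t x hx
    have h2 := hD t x hx
    calc ‖L (f t x) (g t x)‖ ≤ ‖L‖ * ‖f t x‖ * ‖g t x‖ := L.le_opNorm₂ _ _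
      _ ≤ ‖L‖ * (C * ‖x‖ ^ (-a)) * (D * ‖x‖ ^ (-b)) := by
        gcongr
        exact mul_nonneg (norm_nonneg L) ((norm_nonneg _).trans h1)
      _ = _ := by ring

theorem HasLineDerivAt.bilin (L : F →L[ℝ] G →L[ℝ] H) {f : Euc n → F} {g : Euc n → G} {f' : F}
    {g' : G} {x v : Euc n} (hf : HasLineDerivAt ℝ f f' x v) (hg : HasLineDerivAt ℝ g g' x v) :
    HasLineDerivAt ℝ (fun y => L (f y) (g y)) (L (f x) g' + L f' (g x)) x v := by
  have := ContinuousLinearMap.hasDerivAt_of_bilinear (B := L) (fun _ => hf) (fun _ => hg)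
  simpa [HasLineDerivAt] using this

/-- By Leibniz, each term of the derivative has one factor whose exponent has risen by one, so both
terms have class `a + b + 1`. -/
theorem SingClass.bilin (L : F →L[ℝ] G →L[ℝ] H) {N : ℕ} {a b : ℤ} {f : τ → Euc n → F}
    {g : τ → Euc n → G} (hf : SingClass N a f) (hg : SingClass N b g) :
    SingClass N (a + b) fun t x => L (f t x) (g t x) := by
  induction N generalizing a b f g with
  | zero => exact SingBound.bilin L hf hg
  | succ N ih =>
    refine ⟨hf.1.bilin L hg.1, fun i => ?_⟩
    obtain ⟨f', hf1, hf2⟩ := hf.2 i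
    obtain ⟨g', hg1, hg2⟩ := hg.2 i
    refine ⟨_, fun t x hx => HasLineDerivAt.bilin L (hf1 t x hx) (hg1 t x hx), ?_⟩
    have h1 := ih hf.of_succ hg2
    have h2 := ih hf2 hg.of_succ
    rw [← add_assoc] at h1
    rw [add_right_comm] at h2
    exact h1.add h2

theorem SingClass.smul {N : ℕ} {a b : ℤ} {f : τ → Euc n → ℝ}
    {g : τ → Euc n → F} (hf : SingClass N a f) (hg : SingClass N b g) :
    SingClass N (a + b) fun t x => f t x • g t x :=
  SingClass.bilin (ContinuousLinearMap.lsmul ℝ ℝ) hf hg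

theorem SingClass.mul {N : ℕ} {a b : ℤ} {f g : τ → Euc n → ℝ}
    (hf : SingClass N a f) (hg : SingClass N b g) :
    SingClass N (a + b) fun t x => f t x * g t x :=
  hf.smul hg

theorem SingClass.realInner {E : Type*} [NormedAddCommGroup E] [InnerProductSpace ℝ E]
    {N : ℕ} {a b : ℤ} {f g : τ → Euc n → E}
    (hf : SingClass N a f) (hg : SingClass N b g) :
    SingClass N (a + b) fun t x => inner ℝ (f t x) (g t x) :=
  SingClass.bilin (innerSL ℝ) hf hg

/-- On the unit ball `|x|⁻ᵃ ≥ 1` when `a ≥ 0`. -/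
theorem SingBound.of_bounded {a : ℤ} (ha : 0 ≤ a) {f : τ → Euc n → F}
    (hf : ∀ t, ContinuousOn (f t) (puncturedBall n)) (C : ℝ)
    (hC : ∀ t, ∀ x ∈ puncturedBall n, ‖f t x‖ ≤ C) : SingBound a f := by
  refine ⟨hf, C, fun t x hx => (hC t x hx).trans ?_⟩
  obtain ⟨h1, h2⟩ := mem_puncturedBall.mp hx
  have h3 : (1 : ℝ) ≤ ‖x‖ ^ (-a) := by
    rw [zpow_neg]
    exact (one_le_inv₀ (zpow_pos (norm_pos_iff.mpr h2) _)).mpr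
      (zpow_le_one₀ (norm_pos_iff.mpr h2) h1.le ha)
  exact le_mul_of_one_le_right ((norm_nonneg _).trans (hC t x hx)) h3

theorem SingClass.const {N : ℕ} {a : ℤ} (ha : 0 ≤ a) {c : τ → F} (C : ℝ) (hC : ∀ t, ‖c t‖ ≤ C) :
    SingClass N a fun t (_ : Euc n) => c t := by
  induction N generalizing a c C with
  | zero => exact SingBound.of_bounded ha (fun t => continuousOn_const) C fun t x _ => hC t
  | succ N ih =>
    refine ⟨SingBound.of_bounded ha (fun t => continuousOn_const) C fun t x _ => hC t, fun i => ?_⟩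
    refine ⟨fun _ _ => 0, fun t x _ => ?_, ih (by omega) 0 (by simp)⟩
    simpa [HasLineDerivAt] using hasDerivAt_const (0 : ℝ) (c t)

theorem SingClass.zero {N : ℕ} {a : ℤ} : SingClass N a fun (_ : τ) (_ : Euc n) => (0 : F) := by
  have h0 (a : ℤ) : SingBound a fun (_ : τ) (_ : Euc n) => (0 : F) :=
    ⟨fun t => continuousOn_const, 0, fun t x _ => by simp⟩
  induction N generalizing a with
  | zero => exact h0 a
  | succ N ih =>
    refine ⟨h0 a, fun i => ⟨fun _ _ => 0, fun t x _ => ?_, ih⟩⟩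
    simpa [HasLineDerivAt] using hasDerivAt_const (0 : ℝ) (0 : F)

theorem SingClass.sum {ι : Type*} (s : Finset ι) {N : ℕ} {a : ℤ} {f : ι → τ → Euc n → F}
    (hf : ∀ j, SingClass N a (f j)) : SingClass N a fun t x => ∑ j ∈ s, f j t x := by
  classical
  induction s using Finset.induction_on with
  | empty => simpa using SingClass.zero
  | insert j s hj ih => simpa [Finset.sum_insert hj] using (hf j).add ih

theorem SingClass.const_smul {N : ℕ} {a : ℤ} {f : τ → Euc n → F} (hf : SingClass N a f)
    {c : τ → ℝ} (C : ℝ) (hC : ∀ t, ‖c t‖ ≤ C) : SingClass N a fun t x => c t • f t x := by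
  simpa using (SingClass.const (n := n) (N := N) le_rfl C hC).smul hf

theorem SingClass.neg {N : ℕ} {a : ℤ} {f : τ → Euc n → F} (hf : SingClass N a f) :
    SingClass N a fun t x => -f t x := by
  simpa using hf.const_smul (c := fun _ => -1) 1 (by simp)

theorem SingClass.sub {N : ℕ} {a : ℤ} {f g : τ → Euc n → F} (hf : SingClass N a f)
    (hg : SingClass N a g) : SingClass N a fun t x => f t x - g t x := by
  simpa [sub_eq_add_neg] using hf.add hg.neg

theorem SingClass.laplacian {N : ℕ} {a : ℤ} {f : τ → Euc n → F} (h : SingClass (N + 2) a f) :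
    SingClass N (a + 2) fun t => laplacian (f t) := by
  have := SingClass.sum Finset.univ fun i => (h.partialDeriv i).partialDeriv i
  rwa [add_assoc] at this

theorem SingClass.laplacian_iterate {N : ℕ} {a : ℤ} (s : ℕ) {f : τ → Euc n → F}
    (h : SingClass (N + 2 * s) a f) :
    SingClass N (a + 2 * s) fun t => EquatorMap.laplacian^[s] (f t) := by
  induction s generalizing a f with
  | zero => simpa using h
  | succ s ih =>
    have := ih (SingClass.laplacian (N := N + 2 * s) h)
    simp only [Function.iterate_succ_apply]
    convert! this using 1
    push_cast; ring

theorem SingClass.linear (A : Euc n →L[ℝ] F) {N : ℕ} :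
    SingClass N (-1) fun (_ : τ) (x : Euc n) => A x := by
  have h0 : SingBound (-1) fun (_ : τ) (x : Euc n) => A x :=
    ⟨fun t => A.continuous.continuousOn, ‖A‖, fun t x _ => by simpa using A.le_opNorm x⟩
  cases N with
  | zero => exact h0
  | succ N =>
    refine ⟨h0, fun i => ⟨fun _ _ => A (stdVec i), fun t x _ =>
      A.hasFDerivAt.hasLineDerivAt _, SingClass.const (by simp) ‖A (stdVec i)‖ fun _ => le_rfl⟩⟩

theorem hasLineDerivAt_norm_sq (x v : Euc n) :
    HasLineDerivAt ℝ (fun y : Euc n => ‖y‖ ^ 2) (2 * inner ℝ x v) x v := by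
  simpa using (hasStrictFDerivAt_norm_sq x).hasFDerivAt.hasLineDerivAt v

theorem hasLineDerivAt_norm_zpow {x : Euc n} (hx : x ≠ 0) (v : Euc n) (p : ℤ) :
    HasLineDerivAt ℝ (fun y : Euc n => ‖y‖ ^ p) (p * inner ℝ x v * ‖x‖ ^ (p - 2)) x v := by
  have h0 : (0 : ℝ) < ‖x‖ := norm_pos_iff.mpr hx
  have h1 : HasLineDerivAt ℝ (fun y : Euc n => ‖y‖) (inner ℝ x v / ‖x‖) x v := by
    have := HasDerivAt.sqrt (hasLineDerivAt_norm_sq x v) (by simpa using hx)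
    simp only [Real.sqrt_sq (norm_nonneg _), zero_smul, add_zero] at this
    unfold HasLineDerivAt
    convert! this using 1
    field_simp
  have h2 := HasDerivAt.comp (0 : ℝ) (h₂ := fun y : ℝ => y ^ p) (h := fun s : ℝ => ‖x + s • v‖)
    (hasDerivAt_zpow p _ (Or.inl (by simpa using hx))) h1
  unfold HasLineDerivAt
  convert! h2 using 1
  rw [zpow_sub₀ h0.ne', zpow_sub₀ (by simpa using hx)]
  simp only [zero_smul, add_zero, zpow_one, zpow_two]
  field_simp

theorem SingClass.norm_zpow {N : ℕ} (p : ℤ) :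
    SingClass N (-p) fun (_ : τ) (x : Euc n) => ‖x‖ ^ p := by
  have h0 (p : ℤ) : SingBound (-p) fun (_ : τ) (x : Euc n) => ‖x‖ ^ p :=
    ⟨fun t => continuousOn_id.norm.zpow₀ p fun x hx =>
      Or.inl (norm_ne_zero_iff.mpr (mem_puncturedBall.mp hx).2), 1, fun t x _ => by simp⟩
  induction N generalizing p with
  | zero => exact h0 p
  | succ N ih =>
    refine ⟨h0 p, fun i => ⟨_, fun t x hx =>
      hasLineDerivAt_norm_zpow (mem_puncturedBall.mp hx).2 _ p, ?_⟩⟩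
    have h1 : SingClass N (-1) fun (_ : τ) (x : Euc n) => inner ℝ x (stdVec i) :=
      SingClass.linear ((innerSL ℝ).flip (stdVec i))
    have h2 := (h1.const_smul (c := fun _ => (p : ℝ)) ‖(p : ℝ)‖ fun _ => le_rfl).mul (ih (p - 2))
    convert! h2 using 1
    ring

/-- Real powers of a family of class `0` which is bounded below by a positive constant. -/
theorem SingClass.rpow {N : ℕ} {w : τ → Euc n → ℝ} (hw : SingClass N 0 w) {c : ℝ} (hc : 0 < c)
    (hcw : ∀ t, ∀ x ∈ puncturedBall n, c ≤ w t x) (p : ℝ) :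
    SingClass N 0 fun t x => w t x ^ p := by
  have h0 (p : ℝ) : SingBound 0 fun t x => w t x ^ p := by
    obtain ⟨hw, C, hC⟩ := hw.singBound
    refine ⟨fun t => (hw t).rpow_const fun x hx => Or.inl (hc.trans_le (hcw t x hx)).ne',
      max (c ^ p) (C ^ p), fun t x hx => ?_⟩
    have h1 := hcw t x hx
    have h2 : w t x ≤ C := by simpa using (le_abs_self _).trans (hC t x hx)
    rw [Real.norm_of_nonneg (Real.rpow_nonneg (hc.le.trans h1) _)]
    simp only [neg_zero, zpow_zero, mul_one]
    rcases le_total 0 p with hp | hp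
    · exact (Real.rpow_le_rpow (hc.le.trans h1) h2 hp).trans (le_max_right _ _)
    · exact (Real.rpow_le_rpow_of_nonpos hc h1 hp).trans (le_max_left _ _)
  induction N generalizing p with
  | zero => exact h0 p
  | succ N ih =>
    refine ⟨h0 p, fun i => ?_⟩
    obtain ⟨w', hw1, hw2⟩ := hw.2 i
    refine ⟨fun t x => w' t x * (p * w t x ^ (p - 1)), fun t x hx => ?_, ?_⟩
    · have := HasDerivAt.rpow_const (p := p) (hw1 t x hx)
        (Or.inl (by simpa using (hc.trans_le (hcw t x hx)).ne'))
      simpa [HasLineDerivAt, mul_assoc] using this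
    · have := hw2.mul ((ih hw.of_succ (p - 1)).const_smul
        (c := fun _ => p) ‖p‖ fun _ => le_rfl)
      simpa using this

/-- A smooth function with bounded derivatives is of class `0`. -/
theorem SingClass.of_contDiff {φ : Euc n → F} (hφ : ContDiff ℝ ((⊤ : ℕ∞) : WithTop ℕ∞) φ)
    (hc : HasCompactSupport φ) {N : ℕ} {a : ℤ} (ha : 0 ≤ a) :
    SingClass N a fun (_ : τ) => φ := by
  have h0 (φ : Euc n → F) (hφ : ContDiff ℝ ((⊤ : ℕ∞) : WithTop ℕ∞) φ)
      (hc : HasCompactSupport φ) (a : ℤ) (ha : 0 ≤ a) : SingBound a fun (_ : τ) => φ := by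
    obtain ⟨C, hC⟩ := hc.exists_bound_of_continuous hφ.continuous
    exact SingBound.of_bounded ha (fun _ => hφ.continuous.continuousOn) C fun _ x _ => hC x
  induction N generalizing φ a with
  | zero => exact h0 φ hφ hc a ha
  | succ N ih =>
    refine ⟨h0 φ hφ hc a ha, fun i => ⟨fun _ x => fderiv ℝ φ x (stdVec i), fun _ x _ =>
      ((hφ.differentiable (by simp)) x).hasFDerivAt.hasLineDerivAt _, ih ?_ ?_ (by omega)⟩⟩
    · exact (hφ.fderiv_right (m := (⊤ : ℕ∞)) (by simp)).clm_apply contDiff_const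
    · exact hc.fderiv_apply ℝ _

end SingularClass

/-! ### Integration by parts across the singularity -/

section IntegrationByParts

set_option linter.unusedSectionVars false

variable {n : ℕ} {τ F G H : Type*}
  [NormedAddCommGroup F] [NormedSpace ℝ F] [NormedAddCommGroup G] [NormedSpace ℝ G]
  [NormedAddCommGroup H] [NormedSpace ℝ H]

theorem nontrivial_euc (hn : 0 < n) : Nontrivial (Euc n) :=
  ⟨⟨stdVec ⟨0, hn⟩, 0, by simp⟩⟩

theorem integrableOn_norm_zpow (hn : 0 < n) {a : ℤ} (ha : a < n) :
    IntegrableOn (fun x : Euc n => ‖x‖ ^ (-a)) (unitBall n : Set (Euc n)) := by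
  have := nontrivial_euc hn
  change IntegrableOn (fun x : Euc n => ‖x‖ ^ (-a)) (Metric.ball 0 1) volume
  rw [integrableOn_fun_norm_addHaar volume (f := fun y : ℝ => y ^ (-a))]
  -- In polar coordinates the integrand is `r^{n-1} r^{-a}`; as `a < n` is an inequality of
  -- integers, this is a polynomial in `r`.
  obtain ⟨m, hm⟩ : ∃ m : ℕ, (m : ℤ) = n - 1 - a := ⟨(n - 1 - a).toNat, by omega⟩
  have h : IntegrableOn (fun y : ℝ => y ^ m) (Set.Ioo 0 1) :=
    ((continuous_pow m).integrableOn_Icc (a := 0) (b := 1)).mono_set Set.Ioo_subset_Icc_self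
  refine h.congr_fun (fun y hy => ?_) measurableSet_Ioo
  have h1 : ((n - 1 : ℕ) : ℤ) + -a = m := by omega
  simp only [finrank_euclideanSpace, Fintype.card_fin, smul_eq_mul]
  rw [← zpow_natCast, ← zpow_natCast, ← zpow_add₀ hy.1.ne', h1]

theorem puncturedBall_ae_eq (hn : 0 < n) :
    puncturedBall n =ᵐ[volume] (unitBall n : Set (Euc n)) := by
  have := nontrivial_euc hn
  exact sdiff_null_ae_eq_self (measure_singleton _)

theorem ae_mem_puncturedBall (hn : 0 < n) :
    ∀ᵐ x ∂volume.restrict (unitBall n : Set (Euc n)), x ∈ puncturedBall n := by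
  rw [← Measure.restrict_congr_set (puncturedBall_ae_eq hn)]
  exact ae_restrict_mem isOpen_puncturedBall.measurableSet

theorem SingBound.aestronglyMeasurable (hn : 0 < n) {a : ℤ} {f : τ → Euc n → F}
    (h : SingBound a f) (t : τ) :
    AEStronglyMeasurable (f t) (volume.restrict (unitBall n : Set (Euc n))) := by
  rw [← Measure.restrict_congr_set (puncturedBall_ae_eq hn)]
  exact (h.1 t).aestronglyMeasurable isOpen_puncturedBall.measurableSet

theorem SingBound.integrableOn (hn : 0 < n) {a : ℤ} (ha : a < n) {f : τ → Euc n → F}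
    (h : SingBound a f) (t : τ) : IntegrableOn (f t) (unitBall n : Set (Euc n)) := by
  obtain ⟨C, hC⟩ := h.2
  refine ((integrableOn_norm_zpow hn ha).const_mul C).mono' (h.aestronglyMeasurable hn t) ?_
  filter_upwards [ae_mem_puncturedBall hn] with x hx using hC t x hx

theorem SingBound.locallyIntegrableOn (hn : 0 < n) {a : ℤ} (ha : a < n) {f : τ → Euc n → F}
    (h : SingBound a f) (t : τ) : LocallyIntegrableOn (f t) (unitBall n : Set (Euc n)) :=
  (h.integrableOn hn ha t).locallyIntegrableOn

theorem SingBound.memLp_two (hn : 0 < n) {a : ℤ} (ha : 2 * a < n) {f : τ → Euc n → F}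
    (h : SingBound a f) (t : τ) :
    MemLp (f t) 2 (volume.restrict (unitBall n : Set (Euc n))) := by
  have hm := h.aestronglyMeasurable hn t
  obtain ⟨C, hC⟩ := h.2
  rw [memLp_two_iff_integrable_sq_norm hm]
  refine ((integrableOn_norm_zpow hn ha).const_mul (C ^ 2)).mono' (hm.norm.pow 2) ?_
  filter_upwards [ae_mem_puncturedBall hn] with x hx
  rw [Real.norm_of_nonneg (by positivity), two_mul, zpow_norm_add hx, ← pow_two, ← mul_pow]
  gcongr
  exact hC t x hx

/-- The functions of class `SingClass`, seen as constant families. -/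
abbrev SingFun (N : ℕ) (a : ℤ) (f : Euc n → F) : Prop := SingClass N a fun _ : Unit => f

theorem partialDeriv_eq_zero_of_notMem {K : Set (Euc n)} (hK : IsClosed K) {f : Euc n → F}
    (hf : ∀ x ∉ K, f x = 0) (i : Fin n) : ∀ x ∉ K, partialDeriv i f x = 0 := by
  intro x hx
  have h : HasLineDerivAt ℝ (fun _ : Euc n => (0 : F)) 0 x (stdVec i) := by
    simpa [HasLineDerivAt] using hasDerivAt_const (0 : ℝ) (0 : F)
  exact (h.congr_of_eventuallyEq
    (Filter.eventually_of_mem (hK.isOpen_compl.mem_nhds hx) hf)).lineDeriv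

theorem laplacian_eq_zero_of_notMem {K : Set (Euc n)} (hK : IsClosed K) {f : Euc n → F}
    (hf : ∀ x ∉ K, f x = 0) : ∀ x ∉ K, laplacian f x = 0 := fun x hx =>
  Finset.sum_eq_zero fun i _ =>
    partialDeriv_eq_zero_of_notMem hK (partialDeriv_eq_zero_of_notMem hK hf i) i x hx

theorem laplacian_iterate_eq_zero_of_notMem {K : Set (Euc n)} (hK : IsClosed K) (s : ℕ)
    {f : Euc n → F} (hf : ∀ x ∉ K, f x = 0) : ∀ x ∉ K, laplacian^[s] f x = 0 := by
  induction s generalizing f with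
  | zero => exact hf
  | succ s ih => exact ih (laplacian_eq_zero_of_notMem hK hf)

/-- Smooth functions vanishing near the origin which converge to `1` elsewhere, with partial
derivatives of size `O(1 / |x|)`. -/
theorem exists_cutoff (i : Fin n) : ∃ (η η' : ℕ → Euc n → ℝ) (D : ℝ),
    (∀ m, Continuous (η m)) ∧ (∀ m, Continuous (η' m)) ∧ (∀ m x, ‖η m x‖ ≤ 1) ∧
    (∀ m, ∀ x ∈ tsupport (η m), x ≠ 0) ∧
    (∀ m x, HasLineDerivAt ℝ (η m) (η' m x) x (stdVec i)) ∧
    (∀ m x, x ≠ 0 → ‖η' m x‖ ≤ D * ‖x‖⁻¹) ∧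
    (∀ x, x ≠ 0 → ∀ᶠ m in Filter.atTop, η m x = 1) ∧
    (∀ x, x ≠ 0 → ∀ᶠ m in Filter.atTop, η' m x = 0) := by
  let b : ContDiffBump (0 : Euc n) := ⟨1, 2, one_pos, one_lt_two⟩
  have hb : ContDiff ℝ ((⊤ : ℕ∞) : WithTop ℕ∞) b := b.contDiff
  have hb' : Continuous (fderiv ℝ b) := hb.continuous_fderiv (by simp)
  let db : Euc n → ℝ := fun y => fderiv ℝ b y (stdVec i)
  have hdb : Continuous db := hb'.clm_apply continuous_const
  have hdbs : HasCompactSupport db := b.hasCompactSupport.fderiv_apply ℝ (stdVec i)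
  let c : ℕ → ℝ := fun m => m + 1
  have hc (m : ℕ) : 0 < c m := by positivity
  have hbc : Continuous b := hb.continuous
  have hevent (x : Euc n) (hx : x ≠ 0) : ∀ᶠ m in Filter.atTop, 2 < ‖c m • x‖ := by
    have h1 : Filter.Tendsto (fun m => c m * ‖x‖) Filter.atTop Filter.atTop :=
      (Filter.tendsto_atTop_add_const_right _ _ tendsto_natCast_atTop_atTop).atTop_mul_const
        (norm_pos_iff.mpr hx)
    filter_upwards [h1.eventually_gt_atTop 2] with m hm
    rwa [norm_smul, Real.norm_of_nonneg (hc m).le]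
  -- The function `|y| ∂b(y)` is invariant under the rescaling `y = cx`, which gives a bound `D /
  -- |x|` independent of `m`.
  obtain ⟨D, hD⟩ : ∃ D, ∀ y, ‖‖y‖ * db y‖ ≤ D :=
    (hdbs.mul_left (f := fun y : Euc n => ‖y‖)).exists_bound_of_continuous (continuous_norm.mul hdb)
  refine ⟨fun m x => 1 - b (c m • x), fun m x => -(c m * db (c m • x)), D,
    fun m => continuous_const.sub (hbc.comp (continuous_const_smul _)),
    fun m => (continuous_const.mul (hdb.comp (continuous_const_smul _))).neg, fun m x => ?_,
    fun m => ?_, fun m x => ?_, fun m x hx => ?_, fun x hx => ?_, fun x hx => ?_⟩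
  · have h1 := b.nonneg (x := c m • x)
    have h2 := b.le_one (x := c m • x)
    rw [Real.norm_of_nonneg (by linarith)]
    linarith
  · rintro x hx rfl
    refine notMem_tsupport_iff_eventuallyEq.mpr ?_ hx
    filter_upwards [Metric.ball_mem_nhds (0 : Euc n) (inv_pos.mpr (hc m))] with x hx
    have : c m • x ∈ Metric.closedBall (0 : Euc n) b.rIn := by
      have h1 : ‖x‖ < (c m)⁻¹ := by simpa using hx
      have h2 : c m * ‖x‖ < 1 := by
        rw [← lt_div_iff₀' (hc m), one_div]
        exact h1
      simpa [norm_smul, abs_of_pos (hc m)] using h2.le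
    simp [b.one_of_mem_closedBall this]
  · have h1 : HasFDerivAt b (fderiv ℝ b (c m • x)) (c m • x) :=
      (hb.differentiable (by simp) _).hasFDerivAt
    have h2 := (h1.comp x ((hasFDerivAt_id x).const_smul (c m))).const_sub 1
    simpa [db, Function.comp_def] using h2.hasLineDerivAt (stdVec i)
  · have h1 := hD (c m • x)
    rw [← div_eq_mul_inv, le_div_iff₀ (norm_pos_iff.mpr hx)]
    refine le_trans (le_of_eq ?_) h1
    simp only [norm_neg, norm_mul, norm_smul, norm_norm]
    ring
  · filter_upwards [hevent x hx] with m hm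
    have : b (c m • x) = 0 := b.zero_of_le_dist (by simpa using hm.le)
    simp [this]
  · filter_upwards [hevent x hx] with m hm
    have h1 : c m • x ∉ tsupport b := by
      rw [b.tsupport_eq]
      simpa using hm
    have h0 : fderiv ℝ b (c m • x) = 0 :=
      image_eq_zero_of_notMem_tsupport fun h => h1 (tsupport_fderiv_subset ℝ h)
    simp [db, h0]

/-- The integral of a partial derivative of a compactly supported function with a mild singularity
at the origin vanishes. -/
theorem integral_partialDeriv_eq_zero (hn : 0 < n) {a : ℤ} (ha : a + 1 < n) {f : Euc n → F}
    (hf : SingFun 1 a f) {K : Set (Euc n)} (hK : IsClosed K) (hKB : K ⊆ unitBall n)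
    (hfK : ∀ x ∉ K, f x = 0) (i : Fin n) :
    ∫ x in (unitBall n : Set (Euc n)), partialDeriv i f x = 0 := by
  have := nontrivial_euc hn
  set f' := partialDeriv i f with hf'
  have hf'K : ∀ x ∉ K, f' x = 0 := partialDeriv_eq_zero_of_notMem hK hfK i
  have hsupp {g : Euc n → F} (hg : ∀ x ∉ K, g x = 0) :
      Function.support g ⊆ (unitBall n : Set (Euc n)) := fun x hx =>
    hKB (by_contra fun h => hx (hg x h))
  -- Vanishing off `K ⊆ Bⁿ` makes `f` differentiable on all of `ℝⁿ \ {0}`, so no boundary term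
  -- arises on the unit sphere.
  have hder : ∀ x, x ≠ 0 → HasLineDerivAt ℝ f (f' x) x (stdVec i) := by
    intro x hx
    by_cases hxK : x ∈ K
    · exact hf.hasLineDerivAt i () ⟨hKB hxK, hx⟩
    · rw [hf'K x hxK]
      have h : HasLineDerivAt ℝ (fun _ : Euc n => (0 : F)) 0 x (stdVec i) := by
        simpa [HasLineDerivAt] using hasDerivAt_const (0 : ℝ) (0 : F)
      exact h.congr_of_eventuallyEq (Filter.eventually_of_mem (hK.isOpen_compl.mem_nhds hxK) hfK)
  have hbf := hf.singBound
  have hbf' : SingBound (a + 1) fun _ : Unit => f' := (hf.partialDeriv i).singBound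
  have hif : Integrable f := (integrableOn_iff_integrable_of_support_subset (hsupp hfK)).mp
    (hbf.integrableOn hn (by omega) ())
  have hif' : Integrable f' := (integrableOn_iff_integrable_of_support_subset (hsupp hf'K)).mp
    (hbf'.integrableOn hn ha ())
  rw [setIntegral_eq_integral_of_forall_compl_eq_zero fun x hx => hf'K x fun h => hx (hKB h)]
  -- The error term `η'_m f` is dominated by a multiple of `|x|^{-(a+1)}`, integrable because `a + 1
  -- < n`, and is eventually `0` at each `x ≠ 0`; dominated convergence removes it.
  obtain ⟨η, η', D, hηc, hη'c, hη1, hη0, hη, hη'D, hev1, hev0⟩ := exists_cutoff i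
  obtain ⟨C, hC⟩ := hbf.2
  have hsmall (m : ℕ) (x : Euc n) (hx : x ≠ 0) : ‖η' m x • f x‖ ≤
      (unitBall n : Set (Euc n)).indicator (fun x => D * C * ‖x‖ ^ (-(a + 1))) x := by
    by_cases hxK : x ∈ K
    · have hx' : x ∈ puncturedBall n := ⟨hKB hxK, hx⟩
      rw [Set.indicator_of_mem (hKB hxK), norm_smul, zpow_norm_add hx']
      have h1 := hη'D m x hx
      calc ‖η' m x‖ * ‖f x‖ ≤ (D * ‖x‖⁻¹) * (C * ‖x‖ ^ (-a)) := by
            gcongr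
            · exact (norm_nonneg _).trans h1
            · exact hC () x hx'
        _ = _ := by rw [zpow_neg_one]; ring
    · rw [hfK x hxK, smul_zero, norm_zero]
      refine Set.indicator_apply_nonneg fun hxB => ?_
      have h1 : 0 ≤ D * ‖x‖⁻¹ := (norm_nonneg _).trans (hη'D m x hx)
      have h2 : 0 ≤ C * ‖x‖ ^ (-a) := (norm_nonneg _).trans (hC () x ⟨hxB, hx⟩)
      rw [zpow_norm_add ⟨hxB, hx⟩, zpow_neg_one]
      exact (mul_nonneg h1 h2).trans_eq (by ring)
  have hbound : Integrable
      ((unitBall n : Set (Euc n)).indicator fun x => D * C * ‖x‖ ^ (-(a + 1))) :=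
    (integrable_indicator_iff (unitBall n).isOpen.measurableSet).mpr
      ((integrableOn_norm_zpow hn ha).const_mul _)
  have hm1 (m : ℕ) : Integrable fun x => η m x • f' x :=
    hif'.bdd_smul 1 (hηc m).aestronglyMeasurable (.of_forall (hη1 m))
  have hm2 (m : ℕ) : Integrable fun x => η m x • f x :=
    hif.bdd_smul 1 (hηc m).aestronglyMeasurable (.of_forall (hη1 m))
  have hm3 (m : ℕ) : Integrable fun x => η' m x • f x := by
    refine hbound.mono' ((hη'c m).aestronglyMeasurable.smul hif.aestronglyMeasurable) ?_
    filter_upwards [Measure.ae_ne volume 0] with x hx using hsmall m x hx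
  have hparts (m : ℕ) : ∫ x, η' m x • f x = -∫ x, η m x • f' x :=
    integral_bilinear_hasLineDerivAt_right_eq_neg_left_of_integrable
      (B := (ContinuousLinearMap.lsmul ℝ ℝ).flip) (hm1 m) (hm3 m) (hm2 m)
      (fun x hx => hder x (hη0 m x hx)) (fun x _ => hη m x)
  have hlim1 : Filter.Tendsto (fun m => ∫ x, η m x • f' x) Filter.atTop (𝓝 (∫ x, f' x)) := by
    refine tendsto_integral_of_dominated_convergence (fun x => ‖f' x‖)
      (fun m => (hm1 m).aestronglyMeasurable) hif'.norm (fun m => .of_forall fun x => ?_) ?_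
    · rw [norm_smul]
      exact mul_le_of_le_one_left (norm_nonneg _) (hη1 m x)
    · filter_upwards [Measure.ae_ne volume 0] with x hx
      refine tendsto_const_nhds.congr' ?_
      filter_upwards [hev1 x hx] with m hm
      rw [hm, one_smul]
  have hlim2 : Filter.Tendsto (fun m => ∫ x, η' m x • f x) Filter.atTop
      (𝓝 (∫ _x : Euc n, (0 : F))) := by
    refine tendsto_integral_of_dominated_convergence _
      (fun m => (hm3 m).aestronglyMeasurable) hbound (fun m => ?_) ?_
    · filter_upwards [Measure.ae_ne volume 0] with x hx using hsmall m x hx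
    · filter_upwards [Measure.ae_ne volume 0] with x hx
      refine tendsto_const_nhds.congr' ?_
      filter_upwards [hev0 x hx] with m hm
      rw [hm, zero_smul]
  simp only [hparts, integral_zero] at hlim2
  simpa using tendsto_nhds_unique hlim1.neg hlim2

theorem SingFun.partialDeriv_bilin (L : F →L[ℝ] G →L[ℝ] H) {a b : ℤ} {f : Euc n → F}
    {g : Euc n → G} (hf : SingFun 1 a f) (hg : SingFun 1 b g) (i : Fin n) {x : Euc n}
    (hx : x ∈ puncturedBall n) :
    partialDeriv i (fun x => L (f x) (g x)) x =
      L (f x) (partialDeriv i g x) + L (partialDeriv i f x) (g x) :=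
  (HasLineDerivAt.bilin L (hf.hasLineDerivAt i () hx) (hg.hasLineDerivAt i () hx)).lineDeriv

theorem integral_bilin_partialDeriv (hn : 0 < n) (L : F →L[ℝ] G →L[ℝ] H) {a b : ℤ}
    (hab : a + b + 1 < n) {f : Euc n → F} {g : Euc n → G} (hf : SingFun 1 a f)
    (hg : SingFun 1 b g) {K : Set (Euc n)} (hK : IsClosed K) (hKB : K ⊆ unitBall n)
    (hfgK : ∀ x ∉ K, L (f x) (g x) = 0) (i : Fin n) :
    ∫ x in (unitBall n : Set (Euc n)), L (partialDeriv i f x) (g x) =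
      -∫ x in (unitBall n : Set (Euc n)), L (f x) (partialDeriv i g x) := by
  have hfg : SingFun 1 (a + b) fun x => L (f x) (g x) := SingClass.bilin L hf hg
  have h0 := integral_partialDeriv_eq_zero hn hab hfg hK hKB hfgK i
  have h1 : IntegrableOn (fun x => L (partialDeriv i f x) (g x)) (unitBall n : Set (Euc n)) :=
    SingBound.integrableOn (τ := Unit) hn (a := a + 1 + b) (by omega)
      ((hf.partialDeriv i).bilin L hg.of_succ) ()
  have h2 : IntegrableOn (fun x => L (f x) (partialDeriv i g x)) (unitBall n : Set (Euc n)) :=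
    SingBound.integrableOn (τ := Unit) hn (a := a + (b + 1)) (by omega)
      (hf.of_succ.bilin L (hg.partialDeriv i)) ()
  have h3 : ∫ x in (unitBall n : Set (Euc n)), partialDeriv i (fun x => L (f x) (g x)) x =
      ∫ x in (unitBall n : Set (Euc n)),
        (L (f x) (partialDeriv i g x) + L (partialDeriv i f x) (g x)) := by
    refine integral_congr_ae ?_
    filter_upwards [ae_mem_puncturedBall hn] with x hx
    exact SingFun.partialDeriv_bilin L hf hg i hx
  rw [h3, integral_add h2 h1] at h0
  exact eq_neg_of_add_eq_zero_right h0

end IntegrationByParts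

/-! ### Classical derivatives as weak derivatives -/

section WeakDerivatives

set_option linter.unusedSectionVars false

variable {n : ℕ} {τ F : Type*} [NormedAddCommGroup F] [NormedSpace ℝ F]

/-- Induction on the order: the innermost derivative is absorbed into the test function, the
induction hypothesis handles the others, and one integration by parts moves the last one onto `g`.
The surplus `N` leaves `g` differentiable for that step. -/
theorem exists_iterated_weakDeriv (hn : 0 < n) (m : ℕ) {N : ℕ} {a : ℤ} (ha : a + m < n)
    (α : Fin m → Fin n) {f : Euc n → F} (hf : SingFun (N + m) a f) :
    ∃ g : Euc n → F, SingFun N (a + m) g ∧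
      ∀ φ : Euc n → ℝ, ContDiff ℝ ((⊤ : ℕ∞) : WithTop ℕ∞) φ → HasCompactSupport φ →
        tsupport φ ⊆ unitBall n →
        ∫ x in (unitBall n : Set (Euc n)), (iteratedFDeriv ℝ m φ x fun j => stdVec (α j)) • f x =
          (-1 : ℝ) ^ m • ∫ x in (unitBall n : Set (Euc n)), φ x • g x := by
  induction m generalizing N with
  | zero => exact ⟨f, by simpa using hf, fun φ _ _ _ => by simp⟩
  | succ m ih =>
    obtain ⟨g, hg, hφ⟩ := ih (N := N + 1) (by push_cast at ha; omega) (Fin.init α)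
      (by convert! hf using 1; omega)
    refine ⟨partialDeriv (α (Fin.last m)) g, by simpa [add_assoc] using hg.partialDeriv _,
      fun φ h1 h2 h3 => ?_⟩
    set i := α (Fin.last m)
    let ψ : Euc n → ℝ := fun x => fderiv ℝ φ x (stdVec i)
    have hfd : ContDiff ℝ ((⊤ : ℕ∞) : WithTop ℕ∞) (fderiv ℝ φ) := h1.fderiv_right (by simp)
    have hψ1 : ContDiff ℝ ((⊤ : ℕ∞) : WithTop ℕ∞) ψ := hfd.clm_apply contDiff_const
    have hψ2 : HasCompactSupport ψ := h2.fderiv_apply ℝ _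
    have hψ3 : tsupport ψ ⊆ unitBall n := (tsupport_fderiv_apply_subset ℝ _).trans h3
    have hpd : partialDeriv i φ = ψ :=
      funext fun x => ((h1.differentiable (by simp)) x).lineDeriv_eq_fderiv
    have e1 (x : Euc n) : (iteratedFDeriv ℝ (m + 1) φ x fun j => stdVec (α j)) =
        iteratedFDeriv ℝ m ψ x fun j => stdVec (Fin.init α j) := by
      rw [iteratedFDeriv_succ_apply_right,
        iteratedFDeriv_clm_apply_const_apply (n := ((⊤ : ℕ∞) : WithTop ℕ∞)) hfd
          (by exact_mod_cast le_top)]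
      rfl
    simp only [e1]
    rw [hφ ψ hψ1 hψ2 hψ3, ← hpd]
    have := integral_bilin_partialDeriv hn (ContinuousLinearMap.lsmul ℝ ℝ) (a := 0)
      (b := a + m) (by push_cast at ha; omega)
      (SingClass.of_contDiff h1 h2 le_rfl) (hg.mono (by omega)) (isClosed_tsupport φ) h3
      (fun x hx => by simp [image_eq_zero_of_notMem_tsupport hx]) i
    simp only [ContinuousLinearMap.lsmul_apply] at this
    rw [this, pow_succ, mul_smul]
    simp

theorem exists_hasWeakDeriv (hn : 0 < n) (m : ℕ) {a : ℤ} (ha : a + m < n)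
    (α : Fin m → Fin n) {f : Euc n → F} (hf : SingFun m a f) :
    ∃ g : Euc n → F, SingFun 0 (a + m) g ∧ HasWeakDeriv (unitBall n) α f g := by
  obtain ⟨g, hg, h⟩ := exists_iterated_weakDeriv hn m (N := 0) ha α (by simpa using hf)
  exact ⟨g, hg, hf.singBound.locallyIntegrableOn hn (by omega) (),
    hg.singBound.locallyIntegrableOn hn ha (),
    fun φ => h φ φ.contDiff φ.hasCompactSupport φ.tsupport_subset⟩

theorem SingFun.memSobolev (hn : 0 < n) {k : ℕ} (hk : 2 * k < n) {f : Euc n → F}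
    (hf : SingFun k 0 f) : MemSobolev (unitBall n) k f := by
  refine ⟨hf.singBound.memLp_two hn (by omega) (), fun m hm α => ?_⟩
  obtain ⟨g, hg, h⟩ := exists_hasWeakDeriv hn m (by omega) α (hf.mono hm)
  exact ⟨g, h, hg.singBound.memLp_two hn (by omega) ()⟩

theorem SingFun.hasWeakDeriv_partialDeriv (hn : 0 < n) {a : ℤ} (ha : a + 1 < n)
    {f : Euc n → F} (hf : SingFun 1 a f) (i : Fin n) :
    HasWeakDeriv (unitBall n) (fun _ : Fin 1 => i) f (partialDeriv i f) := by
  have hf' : SingFun 0 (a + 1) (partialDeriv i f) := hf.partialDeriv i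
  refine ⟨hf.singBound.locallyIntegrableOn hn (by omega) (),
    hf'.singBound.locallyIntegrableOn hn ha (), fun φ => ?_⟩
  have := integral_bilin_partialDeriv hn (ContinuousLinearMap.lsmul ℝ ℝ) (a := 0)
    (b := a) (by omega) (SingClass.of_contDiff φ.contDiff φ.hasCompactSupport le_rfl) hf
    (isClosed_tsupport φ) φ.tsupport_subset
    (fun x hx => by simp [image_eq_zero_of_notMem_tsupport hx]) i
  have hpd (x : Euc n) : partialDeriv i φ x = fderiv ℝ φ x (stdVec i) :=
    ((φ.contDiff.differentiable (by simp)) x).lineDeriv_eq_fderiv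
  simpa [hpd, iteratedFDeriv_succ_apply_right] using this

theorem HasWeakDeriv.congr_left {Ω : Opens (Euc n)} {m : ℕ} {α : Fin m → Fin n}
    {u v g : Euc n → F} (h : HasWeakDeriv Ω α u g)
    (huv : v =ᵐ[volume.restrict (Ω : Set (Euc n))] u) : HasWeakDeriv Ω α v g := by
  have hloc : LocallyIntegrableOn v (Ω : Set (Euc n)) volume :=
    (locallyIntegrableOn_iff Ω.isOpen.isLocallyClosed).mpr fun K hK hKc =>
      ((locallyIntegrableOn_iff Ω.isOpen.isLocallyClosed).mp h.1 K hK hKc).congr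
        (ae_restrict_of_ae_restrict_of_subset hK huv.symm)
  refine ⟨hloc, h.2.1, fun φ => ?_⟩
  rw [← h.2.2 φ]
  refine integral_congr_ae ?_
  filter_upwards [huv] with x hx
  rw [hx]

/-- The fundamental lemma of the calculus of variations applied to `g - g'`. -/
theorem HasWeakDeriv.ae_eq [CompleteSpace F] {Ω : Opens (Euc n)} {m : ℕ} {α : Fin m → Fin n}
    {u g g' : Euc n → F} (h : HasWeakDeriv Ω α u g) (h' : HasWeakDeriv Ω α u g') :
    g =ᵐ[volume.restrict (Ω : Set (Euc n))] g' := by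
  have key := Ω.isOpen.ae_eq_zero_of_integral_contDiff_smul_eq_zero
      (h.2.1.sub h'.2.1) fun φ h1 h2 h3 => by
    let Φ : 𝓓(Ω, ℝ) := ⟨φ, h1, h2, h3⟩
    have e := (h.2.2 Φ).symm.trans (h'.2.2 Φ)
    have e' := smul_right_injective F (pow_ne_zero m (by norm_num : (-1 : ℝ) ≠ 0)) e
    have hint {g : Euc n → F} (hg : LocallyIntegrableOn g (Ω : Set (Euc n)) volume) :
        Integrable fun x => φ x • g x := by
      have h4 : IntegrableOn (fun x => φ x • g x) (tsupport φ) :=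
        (hg.integrableOn_compact_subset h3 h2).continuousOn_smul h1.continuous.continuousOn h2
      refine (integrableOn_iff_integrable_of_support_subset fun x hx => ?_).mp h4
      exact subset_tsupport _ fun h0 => hx (by simp [h0])
    have hset (g : Euc n → F) :
        ∫ x in (Ω : Set (Euc n)), φ x • g x = ∫ x, φ x • g x :=
      setIntegral_eq_integral_of_forall_compl_eq_zero fun x hx => by
        simp [image_eq_zero_of_notMem_tsupport fun h => hx (h3 h)]
    have e2 : ∫ x, φ x • g x = ∫ x, φ x • g' x := by rw [← hset, ← hset]; exact e'
    simp only [Pi.sub_apply, smul_sub]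
    rw [integral_sub (hint h.2.1) (hint h'.2.1), e2, sub_self]
  rw [Filter.EventuallyEq, ae_restrict_iff' Ω.isOpen.measurableSet]
  filter_upwards [key] with x hx hxΩ
  exact sub_eq_zero.mp (hx hxΩ)

/-- Each `weakPartial` is a chosen representative, so when it is iterated the input `u` is known
only up to a null set; `f` is the regular representative being followed. -/
theorem weakPartial_ae_eq [CompleteSpace F] (hn : 0 < n) {a : ℤ} (ha : a + 1 < n)
    {f u : Euc n → F} (hf : SingFun 1 a f)
    (hu : u =ᵐ[volume.restrict (unitBall n : Set (Euc n))] f) (i : Fin n) :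
    weakPartial (unitBall n) i u =ᵐ[volume.restrict (unitBall n : Set (Euc n))]
      partialDeriv i f := by
  have h := (hf.hasWeakDeriv_partialDeriv hn ha i).congr_left hu
  have hex : ∃ g, HasWeakDeriv (unitBall n) (fun _ : Fin 1 => i) u g := ⟨_, h⟩
  rw [weakPartial, dif_pos hex]
  exact hex.choose_spec.ae_eq h

theorem weakLaplacian_ae_eq [CompleteSpace F] (hn : 0 < n) {a : ℤ} (ha : a + 2 < n)
    {f u : Euc n → F} (hf : SingFun 2 a f)
    (hu : u =ᵐ[volume.restrict (unitBall n : Set (Euc n))] f) :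
    weakLaplacian (unitBall n) u =ᵐ[volume.restrict (unitBall n : Set (Euc n))] laplacian f := by
  have h (i : Fin n) := weakPartial_ae_eq hn (by omega) (hf.partialDeriv i)
    (weakPartial_ae_eq hn (by omega) hf.of_succ hu i) i
  filter_upwards [ae_all_iff.mpr h] with x hx
  exact Finset.sum_congr rfl fun i _ => hx i

theorem weakLaplacian_iterate_ae_eq [CompleteSpace F] (hn : 0 < n) (s : ℕ) {a : ℤ}
    (ha : a + 2 * s < n) {f u : Euc n → F} (hf : SingFun (2 * s) a f)
    (hu : u =ᵐ[volume.restrict (unitBall n : Set (Euc n))] f) :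
    (weakLaplacian (unitBall n))^[s] u =ᵐ[volume.restrict (unitBall n : Set (Euc n))]
      laplacian^[s] f := by
  induction s generalizing a f u with
  | zero => exact hu
  | succ s ih =>
    push_cast at ha
    have hf2 : SingFun (2 * s + 2) a f := hf
    exact ih (a := a + 2) (by omega) hf2.laplacian
      (weakLaplacian_ae_eq hn (by omega) (hf2.mono (by omega)) hu)

/-- For maps with a mild singularity, the energy is that of the classical derivatives. -/
theorem extrinsicEnergy_even [CompleteSpace F] (hn : 0 < n) {s : ℕ} (hk : 2 * s < n)
    {f : Euc n → F} (hf : SingFun (2 * s) 0 f) :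
    extrinsicEnergy (unitBall n) (2 * s) f =
      ∫ x in (unitBall n : Set (Euc n)), ‖laplacian^[s] f x‖ ^ 2 := by
  rw [extrinsicEnergy, if_pos (by simp), Nat.mul_div_cancel_left s two_pos]
  refine integral_congr_ae ?_
  filter_upwards [weakLaplacian_iterate_ae_eq hn s (by omega) hf .rfl] with x hx
  rw [hx]

theorem extrinsicEnergy_odd [CompleteSpace F] (hn : 0 < n) {s : ℕ} (hk : 2 * s + 1 < n)
    {f : Euc n → F} (hf : SingFun (2 * s + 1) 0 f) :
    extrinsicEnergy (unitBall n) (2 * s + 1) f =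
      ∫ x in (unitBall n : Set (Euc n)), ∑ i, ‖partialDeriv i (laplacian^[s] f) x‖ ^ 2 := by
  have hs : (2 * s + 1) / 2 = s := by omega
  rw [extrinsicEnergy, if_neg (by simp), hs]
  have h1 := weakLaplacian_iterate_ae_eq hn s (by omega) hf.of_succ .rfl
  have h2 : SingFun 1 (0 + 2 * s) (laplacian^[s] f) :=
    SingClass.laplacian_iterate (N := 1) s (hf.mono (by omega))
  refine integral_congr_ae ?_
  filter_upwards [ae_all_iff.mpr fun i => weakPartial_ae_eq hn (by omega) h2 h1 i] with x hx
  simp only [hx]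

end WeakDerivatives

/-! ### Linearity of the iterated Laplacian on singular functions -/

section LinearCombinations

set_option linter.unusedSectionVars false

variable {n : ℕ} {τ F : Type*} [NormedAddCommGroup F] [NormedSpace ℝ F]

theorem partialDeriv_congr {f g : Euc n → F} (h : ∀ x ∈ puncturedBall n, f x = g x) (i : Fin n) :
    ∀ x ∈ puncturedBall n, partialDeriv i f x = partialDeriv i g x := fun _ hx =>
  Filter.EventuallyEq.lineDeriv_eq
    (Filter.eventually_of_mem (isOpen_puncturedBall.mem_nhds hx) h)

theorem laplacian_congr {f g : Euc n → F} (h : ∀ x ∈ puncturedBall n, f x = g x) :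
    ∀ x ∈ puncturedBall n, laplacian f x = laplacian g x := fun x hx =>
  Finset.sum_congr rfl fun i _ => partialDeriv_congr (partialDeriv_congr h i) i x hx

theorem partialDeriv_comb {a : ℤ} {v f g h : Euc n → F} (hf : SingFun 1 a f) (hg : SingFun 1 a g)
    (hh : SingFun 1 a h) (c d : ℝ) (hv : ∀ x ∈ puncturedBall n, v x = f x + c • g x + d • h x)
    (i : Fin n) : ∀ x ∈ puncturedBall n,
      partialDeriv i v x =
        partialDeriv i f x + c • partialDeriv i g x + d • partialDeriv i h x := by
  intro x hx
  rw [partialDeriv_congr hv i x hx]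
  have := ((hf.hasLineDerivAt i () hx).fun_add
    (HasDerivAt.fun_const_smul c (hg.hasLineDerivAt i () hx))).fun_add
    (HasDerivAt.fun_const_smul d (hh.hasLineDerivAt i () hx))
  exact HasLineDerivAt.lineDeriv this

theorem laplacian_comb {a : ℤ} {v f g h : Euc n → F} (hf : SingFun 2 a f) (hg : SingFun 2 a g)
    (hh : SingFun 2 a h) (c d : ℝ) (hv : ∀ x ∈ puncturedBall n, v x = f x + c • g x + d • h x) :
    ∀ x ∈ puncturedBall n,
      laplacian v x = laplacian f x + c • laplacian g x + d • laplacian h x := by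
  intro x hx
  simp only [laplacian, Finset.smul_sum, ← Finset.sum_add_distrib]
  exact Finset.sum_congr rfl fun i _ => partialDeriv_comb (hf.partialDeriv i) (hg.partialDeriv i)
    (hh.partialDeriv i) c d
    (partialDeriv_comb hf.of_succ hg.of_succ hh.of_succ c d hv i) i x hx

theorem laplacian_iterate_comb (s : ℕ) {a : ℤ} {v f g h : Euc n → F} (hf : SingFun (2 * s) a f)
    (hg : SingFun (2 * s) a g) (hh : SingFun (2 * s) a h) (c d : ℝ)
    (hv : ∀ x ∈ puncturedBall n, v x = f x + c • g x + d • h x) :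
    ∀ x ∈ puncturedBall n, laplacian^[s] v x =
      laplacian^[s] f x + c • laplacian^[s] g x + d • laplacian^[s] h x := by
  induction s generalizing a v f g h with
  | zero => exact hv
  | succ s ih =>
    have hf' : SingFun (2 * s + 2) a f := hf
    have hg' : SingFun (2 * s + 2) a g := hg
    have hh' : SingFun (2 * s + 2) a h := hh
    exact ih hf'.laplacian hg'.laplacian hh'.laplacian
      (laplacian_comb (hf'.mono (by omega)) (hg'.mono (by omega)) (hh'.mono (by omega)) c d hv)

end LinearCombinations

/-! ### Green's formulas -/

section Green

variable {n : ℕ} {E : Type*} [NormedAddCommGroup E] [InnerProductSpace ℝ E]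

theorem integral_inner_partialDeriv (hn : 0 < n) {a b : ℤ} (hab : a + b + 1 < n) {f g : Euc n → E}
    (hf : SingFun 1 a f) (hg : SingFun 1 b g) {K : Set (Euc n)} (hK : IsClosed K)
    (hKB : K ⊆ unitBall n) (hgK : ∀ x ∉ K, g x = 0) (i : Fin n) :
    ∫ x in (unitBall n : Set (Euc n)), inner ℝ (partialDeriv i f x) (g x) =
      -∫ x in (unitBall n : Set (Euc n)), inner ℝ (f x) (partialDeriv i g x) :=
  integral_bilin_partialDeriv hn (innerSL ℝ) hab hf hg hK hKB (fun x hx => by simp [hgK x hx]) i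

theorem SingFun.integrableOn_inner (hn : 0 < n) {M N : ℕ} {a b : ℤ} (hab : a + b < n)
    {f g : Euc n → E} (hf : SingFun M a f) (hg : SingFun N b g) :
    IntegrableOn (fun x => inner ℝ (f x) (g x)) (unitBall n : Set (Euc n)) :=
  SingBound.integrableOn (τ := Unit) hn hab
    (SingClass.realInner (N := 0) (hf.mono (by omega)) (hg.mono (by omega))) ()

theorem sum_integral_inner_partialDeriv (hn : 0 < n) {a b : ℤ} (hab : a + b + 2 < n)
    {f g : Euc n → E} (hf : SingFun 2 a f) (hg : SingFun 1 b g) {K : Set (Euc n)}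
    (hK : IsClosed K) (hKB : K ⊆ unitBall n) (hgK : ∀ x ∉ K, g x = 0) :
    ∑ i, ∫ x in (unitBall n : Set (Euc n)), inner ℝ (partialDeriv i f x) (partialDeriv i g x) =
      -∫ x in (unitBall n : Set (Euc n)), inner ℝ (laplacian f x) (g x) := by
  simp only [laplacian, sum_inner]
  rw [integral_finsetSum _ fun i _ => SingFun.integrableOn_inner hn (by omega)
    ((hf.partialDeriv i).partialDeriv i) hg, ← Finset.sum_neg_distrib]
  refine Finset.sum_congr rfl fun i _ => ?_
  rw [integral_inner_partialDeriv hn (by omega) (hf.partialDeriv i) hg hK hKB hgK i, neg_neg]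

theorem integral_inner_laplacian (hn : 0 < n) {a b : ℤ} (hab : a + b + 2 < n)
    {f g : Euc n → E} (hf : SingFun 2 a f) (hg : SingFun 2 b g) {K : Set (Euc n)}
    (hK : IsClosed K) (hKB : K ⊆ unitBall n) (hgK : ∀ x ∉ K, g x = 0) :
    ∫ x in (unitBall n : Set (Euc n)), inner ℝ (f x) (laplacian g x) =
      ∫ x in (unitBall n : Set (Euc n)), inner ℝ (laplacian f x) (g x) := by
  rw [← neg_inj, ← sum_integral_inner_partialDeriv hn hab hf hg.of_succ hK hKB hgK]
  simp only [laplacian, inner_sum]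
  rw [integral_finsetSum _ fun i _ => SingFun.integrableOn_inner hn (by omega)
    hf ((hg.partialDeriv i).partialDeriv i), ← Finset.sum_neg_distrib]
  refine Finset.sum_congr rfl fun i _ => ?_
  rw [integral_inner_partialDeriv hn (by omega) hf.of_succ (hg.partialDeriv i) hK hKB
    (partialDeriv_eq_zero_of_notMem hK hgK i) i]

/-- Laplacians move one at a time from `g` to `f`. The total order of singularity `a + b + 2s` is
preserved, and only `g` has to vanish near the boundary. -/
theorem integral_inner_laplacian_iterate (hn : 0 < n) (s : ℕ) {a b : ℤ} (hab : a + b + 2 * s < n)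
    {f g : Euc n → E} (hf : SingFun (2 * s) a f) (hg : SingFun (2 * s) b g) {K : Set (Euc n)}
    (hK : IsClosed K) (hKB : K ⊆ unitBall n) (hgK : ∀ x ∉ K, g x = 0) :
    ∫ x in (unitBall n : Set (Euc n)), inner ℝ (f x) (laplacian^[s] g x) =
      ∫ x in (unitBall n : Set (Euc n)), inner ℝ (laplacian^[s] f x) (g x) := by
  induction s generalizing a b f g with
  | zero => rfl
  | succ s ih =>
    push_cast at hab
    have hf' : SingFun (2 * s + 2) a f := hf
    have hg' : SingFun (2 * s + 2) b g := hg
    have h1 := ih (b := b + 2) (by omega) (hf'.mono (by omega)) hg'.laplacian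
      (laplacian_eq_zero_of_notMem hK hgK)
    have h2 := integral_inner_laplacian hn (a := a + 2 * s) (b := b) (by omega)
      (SingClass.laplacian_iterate (N := 2) s (hf'.mono (by omega))) (hg'.mono (by omega))
      hK hKB hgK
    rw [Function.iterate_succ_apply, h1, h2, Function.iterate_succ_apply']

end Green

/-! ### Differentiating the energy through a second order expansion -/

section QuadraticExpansion

variable {n : ℕ} {E : Type*} [NormedAddCommGroup E] [InnerProductSpace ℝ E]

theorem hasDerivAt_zero_of_quadratic_bound {e : ℝ → ℝ} {b c M δ : ℝ} (hδ : 0 < δ)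
    (h : ∀ t, |t| ≤ δ → |e t - c - t * b| ≤ M * t ^ 2) : HasDerivAt e b 0 := by
  -- At `t = 0` the bound reads `|e 0 - c| ≤ 0`.
  have h0 : e 0 = c := by
    have := h 0 (by simpa using hδ.le)
    simpa [sub_eq_zero] using this
  rw [hasDerivAt_iff_isLittleO_nhds_zero]
  have h1 : (fun t : ℝ => e (0 + t) - e 0 - t • b) =O[𝓝 0] fun t => t ^ 2 := by
    refine Asymptotics.IsBigO.of_bound M ?_
    filter_upwards [Metric.closedBall_mem_nhds (0 : ℝ) hδ] with t ht
    rw [zero_add, h0, smul_eq_mul, Real.norm_eq_abs, Real.norm_of_nonneg (sq_nonneg t)]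
    exact h t (by simpa using ht)
  exact h1.trans_isLittleO (by simpa using Asymptotics.isLittleO_pow_id (𝕜 := ℝ) one_lt_two)

/-- Second order expansion of the `L²`-norm of a curve `A + t B + t² C_t`. -/
theorem exists_quadratic_bound (hn : 0 < n) {a : ℤ} (ha : 2 * a < n) {δ : ℝ}
    {A B : Euc n → E} {C : {t : ℝ // |t| ≤ δ} → Euc n → E}
    (hA : SingFun 0 a A) (hB : SingFun 0 a B) (hC : SingClass 0 a C) :
    ∃ M : ℝ, ∀ t : {t : ℝ // |t| ≤ δ},
      |(∫ x in (unitBall n : Set (Euc n)), ‖A x + t.1 • B x + t.1 ^ 2 • C t x‖ ^ 2) -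
        (∫ x in (unitBall n : Set (Euc n)), ‖A x‖ ^ 2) -
        t.1 * (2 * ∫ x in (unitBall n : Set (Euc n)), inner ℝ (A x) (B x))| ≤ M * t.1 ^ 2 := by
  let τ := {t : ℝ // |t| ≤ δ}
  have hA' : SingClass 0 a fun _ : τ => A := hA.reindex fun _ => ()
  have hB' : SingClass 0 a fun _ : τ => B := hB.reindex fun _ => ()
  have ht1 : ∀ t : τ, ‖2 * t.1‖ ≤ 2 * δ := fun t => by
    rw [norm_mul, Real.norm_two, Real.norm_eq_abs]; linarith [t.2]
  have ht2 : ∀ t : τ, ‖t.1 ^ 2‖ ≤ δ ^ 2 := fun t => by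
    rw [norm_pow, Real.norm_eq_abs]; exact pow_le_pow_left₀ (abs_nonneg _) t.2 2
  -- The coefficient of `t²` in the expanded square; its class `2a < n` gives one integrable bound
  -- for all `|t| ≤ δ`.
  let r : τ → Euc n → ℝ := fun t x => inner ℝ (B x) (B x) + (2 : ℝ) • inner ℝ (A x) (C t x) +
    (2 * t.1) • inner ℝ (B x) (C t x) + (t.1 ^ 2) • inner ℝ (C t x) (C t x)
  have hr : SingClass 0 (a + a) r :=
    (((hB'.realInner hB').add ((hA'.realInner hC).const_smul (c := fun _ => 2) ‖(2 : ℝ)‖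
      fun _ => le_rfl)).add ((hB'.realInner hC).const_smul _ ht1)).add
      ((hC.realInner hC).const_smul _ ht2)
  obtain ⟨D, hD⟩ := hr.singBound.2
  have hbd : IntegrableOn (fun x : Euc n => D * ‖x‖ ^ (-(a + a))) (unitBall n : Set (Euc n)) :=
    (integrableOn_norm_zpow hn (by omega)).const_mul D
  refine ⟨∫ x in (unitBall n : Set (Euc n)), D * ‖x‖ ^ (-(a + a)), fun t => ?_⟩
  have hexp (x : Euc n) : ‖A x + t.1 • B x + t.1 ^ 2 • C t x‖ ^ 2 =
      ‖A x‖ ^ 2 + t.1 * (2 * inner ℝ (A x) (B x)) + t.1 ^ 2 * r t x := by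
    simp only [← real_inner_self_eq_norm_sq, inner_add_left, inner_add_right, inner_smul_left,
      inner_smul_right, r, smul_eq_mul, real_inner_comm (A x) (B x), real_inner_comm (A x) (C t x),
      real_inner_comm (B x) (C t x), conj_trivial]
    ring
  have hi1 : IntegrableOn (fun x => ‖A x‖ ^ 2) (unitBall n : Set (Euc n)) := by
    simpa only [← real_inner_self_eq_norm_sq] using
      SingFun.integrableOn_inner hn (by omega) hA hA
  have hi2 : IntegrableOn (fun x => t.1 * (2 * inner ℝ (A x) (B x))) (unitBall n : Set (Euc n)) :=
    ((SingFun.integrableOn_inner hn (by omega) hA hB).const_mul 2).const_mul _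
  have hi3 : IntegrableOn (fun x => r t x) (unitBall n : Set (Euc n)) :=
    hr.singBound.integrableOn hn (by omega) t
  simp only [hexp]
  have hi12 : IntegrableOn (fun x => ‖A x‖ ^ 2 + t.1 * (2 * inner ℝ (A x) (B x)))
      (unitBall n : Set (Euc n)) := hi1.add hi2
  rw [integral_add hi12 (hi3.const_mul _), integral_add hi1 hi2, integral_const_mul,
    integral_const_mul, integral_const_mul, add_sub_right_comm, add_sub_right_comm,
    add_sub_cancel_left, sub_self, zero_add, abs_mul, abs_of_nonneg (sq_nonneg t.1), mul_comm]
  gcongr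
  rw [← Real.norm_eq_abs]
  refine norm_integral_le_of_norm_le hbd ?_
  filter_upwards [ae_mem_puncturedBall hn] with x hx using hD t x hx

end QuadraticExpansion

/-! ### The equator map and its iterated Laplacians -/

section Equator

variable {n : ℕ}

/-- The linear embedding `x ↦ (x, 0)` of `ℝⁿ` into `ℝⁿ⁺¹`. -/
def equatorEmbed (n : ℕ) : Euc n →L[ℝ] Euc (n + 1) :=
  LinearMap.toContinuousLinearMap
    { toFun := fun x => WithLp.toLp 2 (Fin.snoc (α := fun _ => ℝ) (fun i => x i) 0)
      map_add' := fun x y => by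
        ext i
        refine Fin.lastCases ?_ (fun j => ?_) i <;> simp
      map_smul' := fun c x => by
        ext i
        refine Fin.lastCases ?_ (fun j => ?_) i <;> simp }

theorem equatorEmbed_apply (x : Euc n) : equatorEmbed n x =
    WithLp.toLp 2 (Fin.snoc (α := fun _ => ℝ) (fun i => x i) 0) := rfl

theorem norm_equatorEmbed (x : Euc n) : ‖equatorEmbed n x‖ = ‖x‖ := by
  rw [EuclideanSpace.norm_eq, EuclideanSpace.norm_eq, Fin.sum_univ_castSucc]
  simp [equatorEmbed_apply]

theorem equatorMap_eq : equatorMap n = fun x => ‖x‖ ^ (-1 : ℤ) • equatorEmbed n x := by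
  funext x
  ext i
  refine Fin.lastCases ?_ (fun j => ?_) i
  · simp [equatorMap, equatorEmbed_apply]
  · simp [equatorMap, equatorEmbed_apply, div_eq_inv_mul]

theorem norm_equatorMap {x : Euc n} (hx : x ∈ puncturedBall n) : ‖equatorMap n x‖ = 1 := by
  have : ‖x‖ ≠ 0 := norm_ne_zero_iff.mpr (mem_puncturedBall.mp hx).2
  rw [equatorMap_eq, norm_smul, norm_equatorEmbed]
  simp [this]

theorem singFun_equatorMap (N : ℕ) : SingFun N 0 (equatorMap n) := by
  rw [equatorMap_eq]
  exact SingClass.smul (SingClass.norm_zpow (-1)) (SingClass.linear (equatorEmbed n))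

variable {F : Type*} [NormedAddCommGroup F] [NormedSpace ℝ F]

theorem inner_stdVec (x : Euc n) (i : Fin n) : inner ℝ x (stdVec i) = x i := by
  simp [EuclideanSpace.inner_single_right]

theorem partialDeriv_norm_zpow_smul (A : Euc n →L[ℝ] F) (p : ℤ) (i : Fin n) {x : Euc n}
    (hx : x ≠ 0) : partialDeriv i (fun y => ‖y‖ ^ p • A y) x =
      ‖x‖ ^ p • A (stdVec i) + (p * x i * ‖x‖ ^ (p - 2)) • A x := by
  have h1 := hasLineDerivAt_norm_zpow hx (stdVec i) p
  rw [inner_stdVec] at h1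
  have h2 := A.hasFDerivAt.hasLineDerivAt (x := x) (stdVec i)
  have h3 := HasLineDerivAt.bilin (ContinuousLinearMap.lsmul ℝ ℝ) h1 h2
  rw [partialDeriv]
  simpa using h3.lineDeriv

/-- The Laplacian of `|x|ᵖ` contributes `p (p + n - 2)`, the cross term contributes `2p` by Euler's
identity for the linear map `A`, and `ΔA = 0`. -/
theorem laplacian_norm_zpow_smul (A : Euc n →L[ℝ] F) (p : ℤ) {x : Euc n}
    (hx : x ∈ puncturedBall n) : laplacian (fun y => ‖y‖ ^ p • A y) x =
      (p * (p + n) * ‖x‖ ^ (p - 2)) • A x := by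
  have hx0 := (mem_puncturedBall.mp hx).2
  have h1 (i : Fin n) : partialDeriv i (partialDeriv i fun y => ‖y‖ ^ p • A y) x =
      (2 * p * x i * ‖x‖ ^ (p - 2)) • A (stdVec i) +
        (p * ‖x‖ ^ (p - 2) + p * (p - 2) * x i ^ 2 * ‖x‖ ^ (p - 4)) • A x := by
    rw [partialDeriv_congr (fun y hy =>
      partialDeriv_norm_zpow_smul A p i (mem_puncturedBall.mp hy).2) i x hx]
    have e1 := hasLineDerivAt_norm_zpow hx0 (stdVec i) p
    have e2 := hasLineDerivAt_norm_zpow hx0 (stdVec i) (p - 2)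
    rw [inner_stdVec] at e1 e2
    have e3 : HasLineDerivAt ℝ (fun y : Euc n => y i) 1 x (stdVec i) := by
      simpa using (EuclideanSpace.proj (𝕜 := ℝ) i).hasFDerivAt.hasLineDerivAt (x := x) (stdVec i)
    have e4 := A.hasFDerivAt.hasLineDerivAt (x := x) (stdVec i)
    have e5 := HasLineDerivAt.bilin (ContinuousLinearMap.lsmul ℝ ℝ)
      (HasLineDerivAt.bilin (ContinuousLinearMap.mul ℝ ℝ) e3 e2) e4
    have e6 := (HasDerivAt.smul_const e1 (A (stdVec i))).fun_add
      (HasDerivAt.fun_const_smul (p : ℝ) e5)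
    rw [partialDeriv, lineDeriv]
    refine (congrArg (fun g => deriv g 0) (funext fun r => ?_)).trans (e6.deriv.trans ?_)
    · simp only [ContinuousLinearMap.lsmul_apply, ContinuousLinearMap.mul_apply']
      module
    · have h4 : p - 2 - 2 = p - 4 := by ring
      simp only [ContinuousLinearMap.lsmul_apply, ContinuousLinearMap.mul_apply', h4]
      push_cast
      module
  have h2 : ∑ i, x i • A (stdVec i) = A x := by
    conv_rhs => rw [← (EuclideanSpace.basisFun (Fin n) ℝ).sum_repr x]
    simp
  have h3 : ∑ i, x i ^ 2 = ‖x‖ ^ 2 := by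
    rw [EuclideanSpace.norm_sq_eq]
    simp
  have h4 : ‖x‖ ^ 2 * ‖x‖ ^ (p - 4) = ‖x‖ ^ (p - 2) := by
    rw [← zpow_natCast, ← zpow_add₀ (norm_ne_zero_iff.mpr hx0)]
    congr 1
    push_cast; ring
  have h5 : ∑ i : Fin n, (2 * p * x i * ‖x‖ ^ (p - 2)) • A (stdVec i) =
      (2 * p * ‖x‖ ^ (p - 2)) • A x := by
    rw [← h2, Finset.smul_sum]
    refine Finset.sum_congr rfl fun i _ => ?_
    rw [smul_smul]
    congr 1
    ring
  have h6 : ∑ i : Fin n, (p * ‖x‖ ^ (p - 2) + p * (p - 2) * x i ^ 2 * ‖x‖ ^ (p - 4)) =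
      n * p * ‖x‖ ^ (p - 2) + p * (p - 2) * ‖x‖ ^ (p - 2) := by
    have h7 : ∑ i : Fin n, (p * (p - 2) * x i ^ 2 * ‖x‖ ^ (p - 4) : ℝ) =
        p * (p - 2) * ‖x‖ ^ (p - 2) := by
      rw [← h4, ← h3, Finset.sum_mul, Finset.mul_sum]
      exact Finset.sum_congr rfl fun i _ => by ring
    rw [Finset.sum_add_distrib, h7]
    simp [mul_assoc]
  simp only [laplacian, h1]
  rw [Finset.sum_add_distrib, h5, ← Finset.sum_smul, h6, ← add_smul]
  congr 1
  ring

/-- The iterated Laplacians of the equator map are pointwise multiples of it. -/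
theorem exists_laplacian_iterate_equatorMap (j : ℕ) : ∃ c : ℝ, ∀ x ∈ puncturedBall n,
    laplacian^[j] (equatorMap n) x = (c * ‖x‖ ^ (-(2 * j : ℤ))) • equatorMap n x := by
  suffices h : ∃ c : ℝ, ∀ x ∈ puncturedBall n,
      laplacian^[j] (equatorMap n) x = c • ‖x‖ ^ (-1 - 2 * j : ℤ) • equatorEmbed n x by
    obtain ⟨c, hc⟩ := h
    refine ⟨c, fun x hx => ?_⟩
    rw [hc x hx, equatorMap_eq, smul_smul, smul_smul, mul_assoc,
      ← zpow_add₀ (norm_ne_zero_iff.mpr (mem_puncturedBall.mp hx).2)]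
    ring_nf
  induction j with
  | zero => exact ⟨1, fun x _ => by simp [equatorMap_eq]⟩
  | succ j ih =>
    obtain ⟨c, hc⟩ := ih
    refine ⟨c * ((-1 - 2 * j : ℤ) * ((-1 - 2 * j : ℤ) + n)), fun x hx => ?_⟩
    have h1 : ∀ x ∈ puncturedBall n, laplacian^[j] (equatorMap n) x =
        ‖x‖ ^ (-1 - 2 * j : ℤ) • (c • equatorEmbed n) x := fun x hx => by
      rw [hc x hx, smul_comm]; rfl
    rw [Function.iterate_succ_apply', laplacian_congr h1 x hx,
      laplacian_norm_zpow_smul _ _ hx]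
    have h2 : (-1 - 2 * (j + 1 : ℕ) : ℤ) = -1 - 2 * j - 2 := by push_cast; ring
    rw [h2, smul_apply, smul_smul, smul_smul]
    congr 1
    ring_nf

end Equator

/-! ### Second order expansion of the projected variation -/

section Variation

variable {n : ℕ}

/-- The component of `φ` tangential to the sphere along the equator map. -/
def tangentialPart (φ : Euc n → Euc (n + 1)) : Euc n → Euc (n + 1) :=
  fun x => φ x - (inner ℝ (equatorMap n x) (φ x) : ℝ) • equatorMap n x

theorem singFun_tangentialPart {φ : Euc n → Euc (n + 1)}
    (hφ : ContDiff ℝ ((⊤ : ℕ∞) : WithTop ℕ∞) φ) (hc : HasCompactSupport φ) (N : ℕ) :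
    SingFun N 0 (tangentialPart φ) := by
  have h : SingFun N 0 φ := SingClass.of_contDiff hφ hc le_rfl
  exact h.sub (((singFun_equatorMap N).realInner h).smul (singFun_equatorMap N))

theorem inner_equatorMap_tangentialPart (φ : Euc n → Euc (n + 1)) {x : Euc n}
    (hx : x ∈ puncturedBall n) : inner ℝ (equatorMap n x) (tangentialPart φ x) = 0 := by
  rw [tangentialPart, inner_sub_right, inner_smul_right, real_inner_self_eq_norm_sq,
    norm_equatorMap hx]
  ring

theorem norm_add_smul_sq {E : Type*} [NormedAddCommGroup E] [InnerProductSpace ℝ E] {u φ : E}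
    (hu : ‖u‖ = 1) (t : ℝ) :
    ‖u + t • φ‖ ^ 2 = 1 + t * (2 * inner ℝ u φ + t * inner ℝ φ φ) := by
  rw [← real_inner_self_eq_norm_sq, inner_add_left, inner_add_right, inner_add_right,
    inner_smul_left, inner_smul_left, inner_smul_right, inner_smul_right,
    real_inner_self_eq_norm_sq u, hu, real_inner_comm u φ]
  simp only [conj_trivial]
  ring

/-- With `t y = s² - 1` this is `1/s - 1 + (s² - 1)/2 = (s - 1)² (s + 2) / (2s)`. The remainder is
exact and its only denominators are `s` and `s + 1`, so it keeps class `0` once `s` is bounded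
below. -/
theorem sqrt_inv_expansion {s y t : ℝ} (hs : 0 < s) (h : s ^ 2 = 1 + t * y) :
    s⁻¹ = 1 - t * y / 2 + t ^ 2 * (y ^ 2 * ((s + 2) * (2⁻¹ * s⁻¹ * ((s + 1)⁻¹) ^ 2))) := by
  have h1 : t * y = s ^ 2 - 1 := by linarith
  have h2 : t ^ 2 * (y ^ 2 * ((s + 2) * (2⁻¹ * s⁻¹ * ((s + 1)⁻¹) ^ 2))) =
      (t * y) ^ 2 * ((s + 2) * (2⁻¹ * s⁻¹ * ((s + 1)⁻¹) ^ 2)) := by ring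
  have h3 : s + 1 ≠ 0 := by positivity
  rw [h2, h1]
  field_simp
  ring

/-- Second order expansion of the variations of the equator map, with a remainder of class `0`. -/
theorem exists_variation_expansion {φ : Euc n → Euc (n + 1)}
    (hφ : ContDiff ℝ ((⊤ : ℕ∞) : WithTop ℕ∞) φ) (hc : HasCompactSupport φ) :
    ∃ δ : ℝ, 0 < δ ∧ (∀ t : ℝ, |t| ≤ δ → ∀ x ∈ puncturedBall n, equatorMap n x + t • φ x ≠ 0) ∧
      ∃ R : {t : ℝ // |t| ≤ δ} → Euc n → Euc (n + 1), (∀ N, SingClass N 0 R) ∧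
        ∀ t : {t : ℝ // |t| ≤ δ}, ∀ x ∈ puncturedBall n,
          variation (equatorMap n) φ t.1 x =
            equatorMap n x + t.1 • tangentialPart φ x + t.1 ^ 2 • R t x := by
  obtain ⟨M, hM⟩ := hc.exists_bound_of_continuous hφ.continuous
  have hM0 : 0 ≤ M := (norm_nonneg _).trans (hM 0)
  -- This `δ` forces `|tφ| ≤ 1/2`, hence `|u* + tφ| ≥ 1/2` since `|u*| = 1`.
  have hδ : 0 < 1 / (2 * (M + 1)) := by positivity
  set δ := 1 / (2 * (M + 1)) with hδ'
  have hlow : ∀ t : ℝ, |t| ≤ δ → ∀ x ∈ puncturedBall n, 1 / 2 ≤ ‖equatorMap n x + t • φ x‖ := by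
    intro t ht x hx
    have h1 : ‖t • φ x‖ ≤ 1 / 2 := by
      rw [norm_smul, Real.norm_eq_abs]
      calc |t| * ‖φ x‖ ≤ 1 / (2 * (M + 1)) * (M + 1) := by
            gcongr
            exact (hM x).trans (by linarith)
        _ = 1 / 2 := by field_simp
    have h2 := norm_sub_le_norm_add (equatorMap n x) (t • φ x)
    rw [norm_equatorMap hx] at h2
    linarith
  let τ := {t : ℝ // |t| ≤ δ}
  have ht : ∀ t : τ, ‖t.1‖ ≤ δ := fun t => t.2
  let u := equatorMap n
  let p : Euc n → ℝ := fun x => inner ℝ (u x) (φ x)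
  let q : Euc n → ℝ := fun x => inner ℝ (φ x) (φ x)
  let y : τ → Euc n → ℝ := fun t x => 2 * p x + t.1 * q x
  let w : τ → Euc n → ℝ := fun t x => 1 + t.1 * y t x
  let s : τ → Euc n → ℝ := fun t x => w t x ^ (1 / 2 : ℝ)
  -- The `t²` coefficient of `1 / |u* + tφ|`: the part `t q` of `y` turns `-t y / 2` into `-t p - t²
  -- q / 2`, and the rest is the remainder of `sqrt_inv_expansion`.
  let ρ : τ → Euc n → ℝ := fun t x => -(2⁻¹ * q x) +
    y t x * y t x * ((s t x + 2) * (2⁻¹ * (s t x ^ (-1 : ℝ) * (s t x + 1) ^ (-2 : ℝ))))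
  have hwn : ∀ t : τ, ∀ x ∈ puncturedBall n, w t x = ‖u x + t.1 • φ x‖ ^ 2 := fun t x hx =>
    (norm_add_smul_sq (norm_equatorMap hx) t.1).symm
  have hsn : ∀ t : τ, ∀ x ∈ puncturedBall n, s t x = ‖u x + t.1 • φ x‖ := fun t x hx => by
    simp only [s]
    rw [hwn t x hx, ← Real.sqrt_eq_rpow, Real.sqrt_sq (norm_nonneg _)]
  have hslow : ∀ t : τ, ∀ x ∈ puncturedBall n, 1 / 2 ≤ s t x := fun t x hx => by
    rw [hsn t x hx]; exact hlow t.1 t.2 x hx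
  have hρ (N : ℕ) : SingClass N 0 ρ := by
    have cφ : SingClass N 0 fun _ : τ => φ := SingClass.of_contDiff hφ hc le_rfl
    have cu : SingClass N 0 fun _ : τ => u := (singFun_equatorMap N).reindex fun _ => ()
    have cc (a : ℝ) : SingClass N 0 fun (_ : τ) (_ : Euc n) => a :=
      SingClass.const le_rfl ‖a‖ fun _ => le_rfl
    have cp : SingClass N 0 fun _ : τ => p := cu.realInner cφ
    have cq : SingClass N 0 fun _ : τ => q := cφ.realInner cφ
    have cy : SingClass N 0 y := ((cc 2).mul cp).add (cq.const_smul δ ht)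
    have cw : SingClass N 0 w := (cc 1).add (cy.const_smul δ ht)
    have cs : SingClass N 0 s := cw.rpow (c := (1 / 2) ^ 2) (by norm_num) (fun t x hx => by
      rw [hwn t x hx]
      exact pow_le_pow_left₀ (by norm_num) (hlow t.1 t.2 x hx) 2) _
    have cs1 := cs.rpow (c := 1 / 2) (by norm_num) hslow (-1)
    have cs2 := (cs.add (cc 1)).rpow (c := 1) one_pos (fun t x hx => by
      have := hslow t x hx
      linarith) (-2)
    exact ((cc 2⁻¹).mul cq).neg.add ((cy.mul cy).mul
      ((cs.add (cc 2)).mul ((cc 2⁻¹).mul (cs1.mul cs2))))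
  refine ⟨δ, hδ, fun t ht x hx h0 => ?_,
    fun t x => ρ t x • u x - p x • φ x + t.1 • (ρ t x • φ x), fun N => ?_, fun t x hx => ?_⟩
  · have := hlow t ht x hx
    rw [h0, norm_zero] at this
    norm_num at this
  · have cφ : SingClass N 0 fun _ : τ => φ := SingClass.of_contDiff hφ hc le_rfl
    have cu : SingClass N 0 fun _ : τ => u := (singFun_equatorMap N).reindex fun _ => ()
    exact (((hρ N).smul cu).sub ((cu.realInner cφ).smul cφ)).add
      (((hρ N).smul cφ).const_smul δ ht)
  · have hs0 : 0 < s t x := lt_of_lt_of_le (by norm_num) (hslow t x hx)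
    have hs2 : s t x ^ 2 = 1 + t.1 * y t x := by
      rw [hsn t x hx, ← hwn t x hx]
    have key : (s t x)⁻¹ = 1 - t.1 * p x + t.1 ^ 2 * ρ t x := by
      rw [sqrt_inv_expansion hs0 hs2, inv_pow]
      simp only [ρ, Real.rpow_neg hs0.le, Real.rpow_neg (by linarith : 0 ≤ s t x + 1),
        Real.rpow_one, Real.rpow_two]
      simp only [y]
      ring
    rw [variation, sphereProj, ← hsn t x hx, key]
    simp only [tangentialPart]
    module

end Variation

/-! ### Sobolev membership and harmonicity for `2k < n` -/

section Harmonic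

variable {n k : ℕ}

theorem tangentialPart_eq_zero_of_notMem (φ : Euc n → Euc (n + 1)) :
    ∀ x ∉ tsupport φ, tangentialPart φ x = 0 := fun x hx => by
  simp [tangentialPart, image_eq_zero_of_notMem_tsupport hx]

/-- The integrand vanishes pointwise: `Δʲ u*` is a multiple of `u*`, which is normal to the sphere
at `u*`. This is the weak Euler–Lagrange equation. -/
theorem integral_inner_laplacian_iterate_equatorMap (hn : 0 < n) (φ : Euc n → Euc (n + 1)) (j : ℕ) :
    ∫ x in (unitBall n : Set (Euc n)),
      inner ℝ (laplacian^[j] (equatorMap n) x) (tangentialPart φ x) = 0 := by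
  obtain ⟨c, hc⟩ := exists_laplacian_iterate_equatorMap (n := n) j
  refine integral_eq_zero_of_ae ?_
  filter_upwards [ae_mem_puncturedBall hn] with x hx
  rw [hc x hx, inner_smul_left, inner_equatorMap_tangentialPart φ hx, mul_zero, Pi.zero_apply]

theorem memSobolevSphere_equatorMap (hk : 2 * k < n) :
    MemSobolevSphere n k (equatorMap n) := by
  have hn : 0 < n := by omega
  refine ⟨SingFun.memSobolev hn hk (singFun_equatorMap k), ?_⟩
  filter_upwards [ae_mem_puncturedBall hn] with x hx
  simpa using norm_equatorMap hx

theorem isExtrinsicHarmonic_equatorMap (hk : 2 * k < n) :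
    IsExtrinsicHarmonic n k (equatorMap n) := by
  have hn : 0 < n := by omega
  refine ⟨memSobolevSphere_equatorMap hk, fun φ => ?_⟩
  have hφ : ContDiff ℝ ((⊤ : ℕ∞) : WithTop ℕ∞) φ := φ.contDiff
  have hK : IsClosed (tsupport φ) := isClosed_tsupport _
  have hKB : tsupport φ ⊆ unitBall n := φ.tsupport_subset
  obtain ⟨δ, hδ, hne, R, hR, hexp⟩ := exists_variation_expansion hφ φ.hasCompactSupport
  have hu (N : ℕ) : SingFun N 0 (equatorMap n) := singFun_equatorMap N
  have hψ (N : ℕ) : SingFun N 0 (tangentialPart φ) :=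
    singFun_tangentialPart hφ φ.hasCompactSupport N
  have hψK := tangentialPart_eq_zero_of_notMem φ
  have hRt (N : ℕ) (t : {t : ℝ // |t| ≤ δ}) : SingFun N 0 (R t) := (hR N).reindex fun _ => t
  have hv (N : ℕ) (t : {t : ℝ // |t| ≤ δ}) :
      SingFun N 0 (variation (equatorMap n) φ t.1) :=
    (((hu N).add ((hψ N).const_smul (c := fun _ => t.1) ‖t.1‖ fun _ => le_rfl)).add
      ((hRt N t).const_smul (c := fun _ => t.1 ^ 2) ‖t.1 ^ 2‖ fun _ => le_rfl)).congr
      fun _ => hexp t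
  refine ⟨?_, ?_⟩
  · filter_upwards [Metric.closedBall_mem_nhds (0 : ℝ) hδ] with t ht
    have ht' : |t| ≤ δ := by simpa using ht
    refine ⟨SingFun.memSobolev hn hk (hv k ⟨t, ht'⟩), ?_⟩
    filter_upwards [ae_mem_puncturedBall hn] with x hx
    exact sphereProj_mem (hne t ht' x hx)
  · have hlap (s : ℕ) (t : {t : ℝ // |t| ≤ δ}) := laplacian_iterate_comb s (hu _) (hψ _) (hRt _ t)
      t.1 (t.1 ^ 2) (hexp t)
    have hsing (N s : ℕ) {f : Euc n → Euc (n + 1)} (hf : ∀ N, SingFun N 0 f) :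
        SingFun N (2 * s) (laplacian^[s] f) := by
      simpa using SingClass.laplacian_iterate (N := N) s (hf _)
    have hRsing (N s : ℕ) : SingClass N (2 * s) fun t => laplacian^[s] (R t) := by
      simpa using SingClass.laplacian_iterate (N := N) s (hR _)
    rcases Nat.even_or_odd' k with ⟨s, rfl | rfl⟩
    · obtain ⟨M, hM⟩ := exists_quadratic_bound hn (a := 2 * s) (by omega) (hsing 0 s hu)
        (hsing 0 s hψ) (hRsing 0 s)
      -- The remaining `Δˢ` is moved off `ψ`, giving `∫ ⟨Δ²ˢ u*, ψ⟩`; the order of singularity `4s =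
      -- 2k` is below `n`.
      have hzero : ∫ x in (unitBall n : Set (Euc n)),
          inner ℝ (laplacian^[s] (equatorMap n) x) (laplacian^[s] (tangentialPart φ) x) = 0 := by
        rw [integral_inner_laplacian_iterate hn s (a := 2 * s) (b := 0) (by omega)
          (hsing _ s hu) (hψ _) hK hKB hψK, ← Function.iterate_add_apply]
        exact integral_inner_laplacian_iterate_equatorMap hn φ _
      refine hasDerivAt_zero_of_quadratic_bound hδ (M := M) (c := ∫ x in (unitBall n : Set (Euc n)),
        ‖laplacian^[s] (equatorMap n) x‖ ^ 2) fun t ht => ?_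
      have := hM ⟨t, ht⟩
      rw [hzero, mul_zero] at this
      rw [extrinsicEnergy_even hn (by omega) (hv _ ⟨t, ht⟩)]
      rw [mul_zero] at this ⊢
      refine le_trans (le_of_eq ?_) this
      congr 3
      refine integral_congr_ae ?_
      filter_upwards [ae_mem_puncturedBall hn] with x hx
      rw [hlap s ⟨t, ht⟩ x hx]
    · have hbound (i : Fin n) := exists_quadratic_bound hn (a := 2 * s + 1) (by omega)
        ((hsing 1 s hu).partialDeriv i) ((hsing 1 s hψ).partialDeriv i)
        ((hRsing 1 s).partialDeriv i)
      choose M hM using hbound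
      have hzero : ∑ i, ∫ x in (unitBall n : Set (Euc n)),
          inner ℝ (partialDeriv i (laplacian^[s] (equatorMap n)) x)
            (partialDeriv i (laplacian^[s] (tangentialPart φ)) x) = 0 := by
        rw [sum_integral_inner_partialDeriv hn (a := 2 * s) (b := 2 * s) (by omega)
          (hsing _ s hu) (hsing _ s hψ) hK hKB (laplacian_iterate_eq_zero_of_notMem hK s hψK),
          ← Function.iterate_succ_apply' (laplacian (n := n) (F := Euc (n + 1))),
          integral_inner_laplacian_iterate hn s (a := 2 * (s + 1 : ℕ)) (b := 0)
            (by push_cast; omega)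
          (hsing _ (s + 1) hu) (hψ _) hK hKB hψK, ← Function.iterate_add_apply,
          integral_inner_laplacian_iterate_equatorMap hn φ _, neg_zero]
      refine hasDerivAt_zero_of_quadratic_bound hδ (M := ∑ i, M i)
        (c := ∑ i, ∫ x in (unitBall n : Set (Euc n)),
          ‖partialDeriv i (laplacian^[s] (equatorMap n)) x‖ ^ 2) fun t ht => ?_
      -- Only the sum over `i` of the first order terms is known to vanish, so the quadratic bounds
      -- are summed before `hzero` is used.
      have hsum := Finset.abs_sum_le_sum_abs (s := Finset.univ) (fun i : Fin n =>
        (∫ x in (unitBall n : Set (Euc n)),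
          ‖partialDeriv i (laplacian^[s] (variation (equatorMap n) φ t)) x‖ ^ 2) -
        (∫ x in (unitBall n : Set (Euc n)),
          ‖partialDeriv i (laplacian^[s] (equatorMap n)) x‖ ^ 2) -
        t * (2 * ∫ x in (unitBall n : Set (Euc n)),
          inner ℝ (partialDeriv i (laplacian^[s] (equatorMap n)) x)
            (partialDeriv i (laplacian^[s] (tangentialPart φ)) x)))
      rw [Finset.sum_sub_distrib, Finset.sum_sub_distrib, ← Finset.mul_sum, ← Finset.mul_sum,
        hzero, mul_zero] at hsum
      rw [extrinsicEnergy_odd hn (by omega) (hv _ ⟨t, ht⟩), integral_finsetSum]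
      · refine hsum.trans ?_
        rw [Finset.sum_mul]
        refine Finset.sum_le_sum fun i _ => ?_
        refine le_trans (le_of_eq ?_) (hM i ⟨t, ht⟩)
        congr 3
        refine integral_congr_ae ?_
        filter_upwards [ae_mem_puncturedBall hn] with x hx
        rw [partialDeriv_comb (hsing 1 s hu) (hsing 1 s hψ) (hsing 1 s fun N => hRt N ⟨t, ht⟩)
          t (t ^ 2) (hlap s ⟨t, ht⟩) i x hx]
      · intro i _
        have := (hsing 1 s fun N => hv N ⟨t, ht⟩).partialDeriv i
        change IntegrableOn _ _ _
        simpa only [← real_inner_self_eq_norm_sq] using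
          SingFun.integrableOn_inner hn (by omega) this this

end Harmonic

/-! ### Iterated directional derivatives of test functions -/

section DirectionalDerivative

variable {n : ℕ} {E : Type*} [NormedAddCommGroup E] [NormedSpace ℝ E]

/-- Smooth functions with compact support. -/
def IsTest (φ : Euc n → ℝ) : Prop :=
  ContDiff ℝ ((⊤ : ℕ∞) : WithTop ℕ∞) φ ∧ HasCompactSupport φ

/-- The derivative in direction `e`. -/
def dirDeriv (e : Euc n) (φ : Euc n → ℝ) : Euc n → ℝ := fun x => fderiv ℝ φ x e

theorem IsTest.dirDeriv {φ : Euc n → ℝ} (h : IsTest φ) (e : Euc n) : IsTest (dirDeriv e φ) :=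
  ⟨(h.1.fderiv_right (m := (⊤ : ℕ∞)) (by simp)).clm_apply contDiff_const, h.2.fderiv_apply ℝ e⟩

theorem IsTest.dirDeriv_iterate {φ : Euc n → ℝ} (h : IsTest φ) (e : Euc n) (m : ℕ) :
    IsTest ((EquatorMap.dirDeriv e)^[m] φ) := by
  induction m with
  | zero => exact h
  | succ m ih => rw [Function.iterate_succ_apply']; exact ih.dirDeriv e

theorem tsupport_dirDeriv_iterate_subset (e : Euc n) (φ : Euc n → ℝ) (m : ℕ) :
    tsupport ((EquatorMap.dirDeriv e)^[m] φ) ⊆ tsupport φ := by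
  induction m with
  | zero => exact subset_rfl
  | succ m ih =>
    rw [Function.iterate_succ_apply']
    exact (tsupport_fderiv_apply_subset ℝ e).trans ih

theorem IsTest.integrable {φ : Euc n → ℝ} (h : IsTest φ) : Integrable φ :=
  h.1.continuous.integrable_of_hasCompactSupport h.2

theorem IsTest.comp_affine {φ : Euc n → ℝ} (h : IsTest φ) (a : Euc n) {c : ℝ} (hc : c ≠ 0) :
    IsTest fun x => φ (a + c • x) :=
  ⟨h.1.comp (by fun_prop),
    h.2.comp_homeomorph ((Homeomorph.smulOfNeZero c hc).trans (Homeomorph.addLeft a))⟩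

theorem iteratedFDeriv_eq_dirDeriv_iterate {φ : Euc n → ℝ} (h : IsTest φ) (e : Euc n) (m : ℕ)
    (x : Euc n) : (iteratedFDeriv ℝ m φ x fun _ => e) = (dirDeriv e)^[m] φ x := by
  induction m generalizing φ with
  | zero => simp
  | succ m ih =>
    have hfd : ContDiff ℝ ((⊤ : ℕ∞) : WithTop ℕ∞) (fderiv ℝ φ) := h.1.fderiv_right (by simp)
    rw [Function.iterate_succ_apply, ← ih (h.dirDeriv e), iteratedFDeriv_succ_apply_right]
    exact (iteratedFDeriv_clm_apply_const_apply (n := ((⊤ : ℕ∞) : WithTop ℕ∞)) hfd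
          (by exact_mod_cast le_top)).symm

theorem dirDeriv_comp_affine {φ : Euc n → ℝ} (h : IsTest φ) (e a : Euc n) (c : ℝ) :
    dirDeriv e (fun x => φ (a + c • x)) = fun x => c * dirDeriv e φ (a + c • x) := by
  funext x
  have h1 : HasFDerivAt φ (fderiv ℝ φ (a + c • x)) (a + c • x) :=
    (h.1.differentiable (by simp) _).hasFDerivAt
  have h2 : HasFDerivAt (fun x : Euc n => a + c • x) (c • ContinuousLinearMap.id ℝ (Euc n)) x :=
    ((hasFDerivAt_id x).const_smul c).const_add a
  have h3 := (h1.comp x h2).fderiv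
  simp only [Function.comp_def] at h3
  simp [dirDeriv, h3]

theorem dirDeriv_const_mul {φ : Euc n → ℝ} (h : IsTest φ) (e : Euc n) (c : ℝ) :
    dirDeriv e (fun x => c * φ x) = fun x => c * dirDeriv e φ x := by
  funext x
  have h1 := ((h.1.differentiable (by simp) x).hasFDerivAt.const_mul c).fderiv
  simp [dirDeriv, h1]

theorem dirDeriv_iterate_comp_affine {φ : Euc n → ℝ} (h : IsTest φ) (e a : Euc n) {c : ℝ}
    (hc : c ≠ 0) (m : ℕ) :
    (dirDeriv e)^[m] (fun x => φ (a + c • x)) =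
      fun x => c ^ m * (dirDeriv e)^[m] φ (a + c • x) := by
  induction m with
  | zero => simp
  | succ m ih =>
    have h1 := h.dirDeriv_iterate e m
    rw [Function.iterate_succ_apply', ih, dirDeriv_const_mul (h1.comp_affine a hc),
      dirDeriv_comp_affine h1, Function.iterate_succ_apply']
    funext x
    ring

/-- A bounded affine function has slope zero. -/
theorem eq_zero_of_bounded_of_hasDerivAt_const {h : ℝ → E} {c : E} {M : ℝ}
    (hM : ∀ s, ‖h s‖ ≤ M) (hd : ∀ s, HasDerivAt h c s) : c = 0 := by
  have h1 (s : ℝ) : HasDerivAt (fun s => h s - s • c) 0 s := by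
    simpa using (hd s).fun_sub ((hasDerivAt_id s).smul_const c)
  have h2 (s : ℝ) : h s - s • c = h 0 := by
    simpa using is_const_of_deriv_eq_zero (fun s => (h1 s).differentiableAt)
      (fun s => (h1 s).deriv) s 0
  by_contra hc
  have hc' : 0 < ‖c‖ := norm_pos_iff.mpr hc
  have h3 (s : ℝ) : |s| * ‖c‖ ≤ 2 * M := by
    rw [← Real.norm_eq_abs, ← norm_smul, show s • c = h s - h 0 by rw [← h2 s]; abel]
    exact (norm_sub_le _ _).trans (by linarith [hM s, hM 0])
  have h4 := h3 ((2 * M + 1) / ‖c‖)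
  have h5 : (2 * M + 1) / ‖c‖ * ‖c‖ = 2 * M + 1 := div_mul_cancel₀ _ hc'.ne'
  have h6 := mul_le_mul_of_nonneg_right (le_abs_self ((2 * M + 1) / ‖c‖)) hc'.le
  linarith

end DirectionalDerivative

/-! ### No iterated directional derivative of the equator map vanishes weakly -/

section Convolution

variable {n : ℕ}

theorem norm_equatorMap_le (x : Euc n) : ‖equatorMap n x‖ ≤ 1 := by
  rw [equatorMap_eq, norm_smul, norm_equatorEmbed, zpow_neg_one, norm_inv, norm_norm]
  exact inv_mul_le_one

theorem measurable_equatorMap : Measurable (equatorMap n) := by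
  rw [equatorMap_eq]
  have h1 : Measurable fun x : Euc n => ‖x‖ ^ (-1 : ℤ) := by
    simp only [zpow_neg_one]
    exact measurable_norm.inv
  exact h1.smul (equatorEmbed n).continuous.measurable

theorem locallyIntegrable_equatorMap : LocallyIntegrable (equatorMap n) :=
  (locallyIntegrable_const (1 : ℝ)).mono measurable_equatorMap.aestronglyMeasurable
    (.of_forall fun x => by simpa using norm_equatorMap_le x)

theorem equatorMap_smul {c : ℝ} (hc : 0 < c) (x : Euc n) :
    equatorMap n (c • x) = equatorMap n x := by
  simp only [equatorMap_eq, norm_smul, map_smul, smul_smul, zpow_neg_one, Real.norm_eq_abs,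
    abs_of_pos hc]
  congr 1
  field_simp

theorem equatorMap_neg (x : Euc n) : equatorMap n (-x) = -equatorMap n x := by
  simp [equatorMap_eq]

theorem continuousAt_equatorMap {x : Euc n} (hx : x ≠ 0) : ContinuousAt (equatorMap n) x := by
  rw [equatorMap_eq]
  exact (continuousAt_id.norm.zpow₀ _ (Or.inl (by simpa using hx))).smul
    (equatorEmbed n).continuous.continuousAt

/-- The convolution of the equator map with a test function. -/
def equatorConv (φ : Euc n → ℝ) : Euc n → Euc (n + 1) :=
  convolution (equatorMap n) φ (ContinuousLinearMap.lsmul ℝ ℝ).flip volume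

theorem equatorConv_apply_swap (φ : Euc n → ℝ) (y : Euc n) :
    equatorConv φ y = ∫ x, φ x • equatorMap n (y - x) := by
  rw [equatorConv, convolution_eq_swap]
  rfl

theorem norm_equatorConv_le {φ : Euc n → ℝ} (h : IsTest φ) (y : Euc n) :
    ‖equatorConv φ y‖ ≤ ∫ x, ‖φ x‖ := by
  rw [equatorConv_apply_swap]
  refine norm_integral_le_of_norm_le h.integrable.norm (.of_forall fun x => ?_)
  rw [norm_smul]
  exact mul_le_of_le_one_right (norm_nonneg _) (norm_equatorMap_le _)

theorem hasDerivAt_equatorConv {φ : Euc n → ℝ} (h : IsTest φ) (y e : Euc n) (s : ℝ) :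
    HasDerivAt (fun s : ℝ => equatorConv φ (y + s • e))
      (equatorConv (dirDeriv e φ) (y + s • e)) s := by
  have h1 := h.2.hasFDerivAt_convolution_right (ContinuousLinearMap.lsmul ℝ ℝ).flip
    (locallyIntegrable_equatorMap (n := n)) (h.1.of_le (by exact_mod_cast le_top)) (y + s • e)
  have h2 : HasDerivAt (fun s : ℝ => y + s • e) e s := by
    simpa using ((hasDerivAt_id s).smul_const e).const_add y
  have h3 := h1.comp_hasDerivAt s h2
  rw [convolution_precompR_apply _ locallyIntegrable_equatorMap (h.2.fderiv ℝ)
    (h.1.continuous_fderiv (by simp))] at h3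
  exact h3

/-- By homogeneity `u*(me - x) = u*(e - x/m)`, and `u*` is continuous at `e ≠ 0`. -/
theorem tendsto_equatorMap_sub {e : Euc n} (he : e ≠ 0) (x : Euc n) :
    Filter.Tendsto (fun m : ℕ => equatorMap n ((m : ℝ) • e - x)) Filter.atTop
      (𝓝 (equatorMap n e)) := by
  have h1 : Filter.Tendsto (fun m : ℕ => e - (m : ℝ)⁻¹ • x) Filter.atTop (𝓝 e) := by
    simpa using tendsto_const_nhds.sub
      ((tendsto_inv_atTop_nhds_zero_nat (𝕜 := ℝ)).smul_const x)
  refine ((continuousAt_equatorMap he).tendsto.comp h1).congr' ?_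
  filter_upwards [Filter.eventually_gt_atTop 0] with m hm
  have hm' : (0 : ℝ) < m := by exact_mod_cast hm
  rw [Function.comp_apply, ← equatorMap_smul hm', smul_sub, smul_inv_smul₀ hm'.ne']

theorem tendsto_equatorConv {φ : Euc n → ℝ} (h : IsTest φ) {e : Euc n} (he : e ≠ 0) :
    Filter.Tendsto (fun m : ℕ => equatorConv φ ((m : ℝ) • e)) Filter.atTop
      (𝓝 ((∫ x, φ x) • equatorMap n e)) := by
  simp only [equatorConv_apply_swap]
  rw [← integral_smul_const]
  refine tendsto_integral_of_dominated_convergence (fun x => ‖φ x‖) (fun m => ?_)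
    h.integrable.norm (fun m => .of_forall fun x => ?_) (.of_forall fun x => ?_)
  · exact h.1.continuous.aestronglyMeasurable.smul
      (measurable_equatorMap.comp (measurable_const.sub measurable_id)).aestronglyMeasurable
  · rw [norm_smul]
    exact mul_le_of_le_one_right (norm_nonneg _) (norm_equatorMap_le _)
  · exact (tendsto_equatorMap_sub he x).const_smul _

/-- The order descends by one at a time: if `u* ∗ ∂ᵏ⁺²φ = 0`, then `u* ∗ ∂ᵏ⁺¹φ` is constant along
lines in direction `e`, where it is the derivative of the bounded function `u* ∗ ∂ᵏφ`, so it is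
zero. -/
theorem equatorConv_dirDeriv_eq_zero {e : Euc n} (k : ℕ)
    (h : ∀ φ : Euc n → ℝ, IsTest φ → ∀ y, equatorConv ((dirDeriv e)^[k + 1] φ) y = 0) :
    ∀ φ : Euc n → ℝ, IsTest φ → ∀ y, equatorConv (dirDeriv e φ) y = 0 := by
  induction k with
  | zero => exact h
  | succ k ih =>
    refine ih fun φ hφ y => ?_
    have h0 := hφ.dirDeriv_iterate e k
    have h1 := hφ.dirDeriv_iterate e (k + 1)
    have hconst (s : ℝ) : equatorConv ((dirDeriv e)^[k + 1] φ) (y + s • e) =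
        equatorConv ((dirDeriv e)^[k + 1] φ) y := by
      have hd (s : ℝ) : HasDerivAt
          (fun s : ℝ => equatorConv ((dirDeriv e)^[k + 1] φ) (y + s • e)) 0 s := by
        have := hasDerivAt_equatorConv h1 y e s
        rwa [← Function.iterate_succ_apply' (dirDeriv e), h φ hφ] at this
      simpa using is_const_of_deriv_eq_zero (fun s => (hd s).differentiableAt)
        (fun s => (hd s).deriv) s 0
    refine eq_zero_of_bounded_of_hasDerivAt_const
      (h := fun s : ℝ => equatorConv ((dirDeriv e)^[k] φ) (y + s • e))
      (fun s => norm_equatorConv_le h0 _) fun s => ?_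
    have := hasDerivAt_equatorConv h0 y e s
    rwa [← Function.iterate_succ_apply' (dirDeriv e), hconst] at this

/-- No iterated directional derivative of the equator map vanishes in the weak sense. -/
theorem exists_equatorConv_dirDeriv_iterate_ne_zero {e : Euc n} (he : e ≠ 0) (k : ℕ) :
    ∃ φ : Euc n → ℝ, IsTest φ ∧ ∃ y, equatorConv ((dirDeriv e)^[k + 1] φ) y ≠ 0 := by
  by_contra! h
  have h1 := equatorConv_dirDeriv_eq_zero k h
  let b : ContDiffBump (0 : Euc n) := ⟨1, 2, one_pos, one_lt_two⟩
  have hb : IsTest b := ⟨b.contDiff, b.hasCompactSupport⟩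
  have hconst (s : ℝ) : equatorConv b (s • e) = equatorConv b 0 := by
    have hd (s : ℝ) : HasDerivAt (fun s : ℝ => equatorConv b (0 + s • e)) 0 s := by
      have := hasDerivAt_equatorConv hb 0 e s
      rwa [h1 b hb] at this
    simpa using is_const_of_deriv_eq_zero (fun s => (hd s).differentiableAt)
      (fun s => (hd s).deriv) s 0
  -- A function constant on the line `ℝ e` would have equal limits at both ends, but these are `± (∫
  -- b) u*(e) ≠ 0`.
  have t1 := tendsto_equatorConv hb he
  have t2 := tendsto_equatorConv hb (neg_ne_zero.mpr he)
  simp only [smul_neg, ← neg_smul, hconst] at t1 t2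
  have e1 := tendsto_nhds_unique t1 t2
  rw [equatorMap_neg, smul_neg, eq_neg_iff_add_eq_zero, ← two_smul ℝ, smul_eq_zero,
    smul_eq_zero] at e1
  rcases e1.resolve_left two_ne_zero with e1 | e1
  · exact (b.integral_pos (μ := volume)).ne' e1
  · simp only [equatorMap_eq] at e1
    have : ‖‖e‖ ^ (-1 : ℤ) • equatorEmbed n e‖ = 1 := by
      rw [norm_smul, norm_equatorEmbed]
      simp [he]
    rw [e1, norm_zero] at this
    exact zero_ne_one this

end Convolution

/-! ### Failure of `W^{k,2}` for `n ≤ 2k` by scaling -/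

section Scaling

variable {n k : ℕ}

/-- Pairing with `φ(l·)` multiplies the left side by `l^{k-n}`, while `g` is seen only on a ball of
radius `r/l`, where its `L²` norm tends to zero. The case `n = 2k` is scale invariant and relies on
that decay alone. Rescaling also lets `φ` have support outside the unit ball. -/
theorem integral_dirDeriv_iterate_smul_equatorMap_eq_zero (hn : 0 < n) (hk : n ≤ 2 * k)
    {i : Fin n} {g : Euc n → Euc (n + 1)}
    (hw : HasWeakDeriv (unitBall n) (fun _ : Fin k => i) (equatorMap n) g)
    (hg : MemLp g 2 (volume.restrict (unitBall n : Set (Euc n)))) {φ : Euc n → ℝ}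
    (hφ : IsTest φ) : ∫ x, (dirDeriv (stdVec i))^[k] φ x • equatorMap n x = 0 := by
  have := nontrivial_euc hn
  set T := ∫ x, (dirDeriv (stdVec i))^[k] φ x • equatorMap n x with hT
  obtain ⟨M, hM⟩ := hφ.2.exists_bound_of_continuous hφ.1.continuous
  have hM0 : 0 ≤ M := (norm_nonneg _).trans (hM 0)
  obtain ⟨r, hr, hφr⟩ := hφ.2.isBounded.subset_ball_lt 0 0
  have hg2 : IntegrableOn (fun x => ‖g x‖ ^ 2) (unitBall n : Set (Euc n)) :=
    hg.integrable_norm_pow (by norm_num)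
  let A : ℝ → Set (Euc n) := fun l => Metric.ball 0 (r / l)
  have hA (l : ℝ) : MeasurableSet (A l) := Metric.isOpen_ball.measurableSet
  have hAB {l : ℝ} (hl : r < l) : A l ⊆ unitBall n :=
    Metric.ball_subset_ball ((div_le_one (hr.trans hl)).mpr hl.le)
  have hscale {l : ℝ} (hl : r < l) :
      T = (l ^ n * (l ^ k)⁻¹ * (-1) ^ k) •
        ∫ x in (unitBall n : Set (Euc n)), φ (l • x) • g x := by
    have hl0 : 0 < l := hr.trans hl
    have h1 : IsTest fun x => φ (0 + l • x) := hφ.comp_affine 0 hl0.ne'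
    have h2 : tsupport (fun x => φ (0 + l • x)) ⊆ A l := fun x hx => by
      have hx' : 0 + l • x ∈ Metric.ball (0 : Euc n) r :=
        hφr (tsupport_comp_subset_preimage φ (f := fun x : Euc n => 0 + l • x) (by fun_prop) hx)
      simpa [A, norm_smul, abs_of_pos hl0, lt_div_iff₀' hl0] using hx'
    have h3 : ∫ x in (unitBall n : Set (Euc n)),
        (iteratedFDeriv ℝ k (fun x => φ (0 + l • x)) x fun _ => stdVec i) • equatorMap n x =
        ((-1) ^ k : ℝ) • ∫ x in (unitBall n : Set (Euc n)), φ (0 + l • x) • g x :=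
      hw.2.2 ⟨_, h1.1, h1.2, h2.trans (hAB hl)⟩
    simp only [iteratedFDeriv_eq_dirDeriv_iterate h1] at h3
    rw [setIntegral_eq_integral_of_forall_compl_eq_zero fun x hx => by
      rw [image_eq_zero_of_notMem_tsupport fun h =>
        hx (hAB hl (h2 (tsupport_dirDeriv_iterate_subset _ _ _ h))), zero_smul],
      dirDeriv_iterate_comp_affine hφ _ _ hl0.ne'] at h3
    have h4 : ∫ x, (l ^ k * (dirDeriv (stdVec i))^[k] φ (0 + l • x)) • equatorMap n x =
        (l ^ k * (l ^ n)⁻¹) • T := by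
      have h5 := Measure.integral_comp_smul volume
        (fun x => (dirDeriv (stdVec i))^[k] φ x • equatorMap n x) l
      simp only [equatorMap_smul hl0, finrank_euclideanSpace, Fintype.card_fin] at h5
      rw [abs_of_pos (by positivity)] at h5
      simp only [zero_add, mul_smul]
      rw [integral_smul, h5]
    rw [h4] at h3
    simp only [zero_add] at h3
    rw [mul_smul, ← h3, smul_smul]
    have h6 : l ^ n * (l ^ k)⁻¹ * (l ^ k * (l ^ n)⁻¹) = 1 := by field_simp
    rw [h6, one_smul]
  have hest (ε : ℝ) (hε : 0 < ε) {l : ℝ} (hl : r < l) (hl1 : 1 ≤ l) :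
      ‖T‖ ≤ M * (ε * (r ^ n * volume.real (Metric.ball (0 : Euc n) 1)) +
        ε⁻¹ * ∫ x in (unitBall n : Set (Euc n)), (A l).indicator (fun x => ‖g x‖ ^ 2) x) := by
    have hl0 : 0 < l := hr.trans hl
    have hint1 : IntegrableOn ((A l).indicator fun _ => ε * l ^ n) (unitBall n : Set (Euc n)) :=
      ((integrableOn_const (C := ε * l ^ n) (s := (unitBall n : Set (Euc n)))
        (measure_ball_lt_top (x := (0 : Euc n)) (r := 1)).ne).indicator (hA l))
    have hint2 : IntegrableOn ((A l).indicator fun x => ‖g x‖ ^ 2) (unitBall n : Set (Euc n)) :=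
      hg2.indicator (hA l)
    have hval : ∫ x in (unitBall n : Set (Euc n)), (A l).indicator (fun _ => ε * l ^ n) x =
        ε * (r ^ n * volume.real (Metric.ball (0 : Euc n) 1)) := by
      rw [setIntegral_indicator (hA l), Set.inter_eq_right.mpr (hAB hl), setIntegral_const,
        smul_eq_mul, Measure.real, Measure.addHaar_ball _ _ (by positivity), ENNReal.toReal_mul,
        ENNReal.toReal_ofReal (by positivity), finrank_euclideanSpace, Fintype.card_fin,
        Measure.real, div_pow]
      field_simp
    rw [← hval, ← integral_const_mul ε⁻¹, ← integral_add hint1 (hint2.const_mul _),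
      ← integral_const_mul, hscale hl, ← integral_smul]
    refine norm_integral_le_of_norm_le ((hint1.add (hint2.const_mul _)).const_mul M)
      (.of_forall fun x => ?_)
    by_cases hx : x ∈ A l
    · have h1 : ‖l ^ n * (l ^ k)⁻¹ * (-1 : ℝ) ^ k‖ = l ^ n * (l ^ k)⁻¹ := by
        rw [norm_mul, norm_pow (-1 : ℝ), norm_neg, norm_one, one_pow, mul_one,
          Real.norm_of_nonneg (by positivity)]
      -- The only use of `n ≤ 2k`: the square is `l^n · l^{n-2k}` and `l ≥ 1`.
      have h2 : (l ^ n * (l ^ k)⁻¹) ^ 2 ≤ l ^ n := by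
        have h3 : l ^ n ≤ (l ^ k) ^ 2 := by
          rw [← pow_mul, mul_comm]
          exact pow_le_pow_right₀ hl1 hk
        have h4 : 0 < (l ^ k) ^ 2 := by positivity
        rw [mul_pow, inv_pow, ← div_eq_mul_inv, div_le_iff₀ h4, sq]
        gcongr
      -- Young's inequality with weight `ε` in place of Cauchy–Schwarz; the integral of `l^n` over
      -- the ball of radius `r/l` does not depend on `l`.
      have h5 : l ^ n * (l ^ k)⁻¹ * ‖g x‖ ≤ ε * l ^ n + ε⁻¹ * ‖g x‖ ^ 2 := by
        set a := l ^ n * (l ^ k)⁻¹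
        have h6 : 0 ≤ ε⁻¹ * (ε * a - ‖g x‖) ^ 2 := by positivity
        have h7 : ε⁻¹ * (ε * a - ‖g x‖) ^ 2 =
            ε * a ^ 2 - 2 * (a * ‖g x‖) + ε⁻¹ * ‖g x‖ ^ 2 := by
          field_simp
          ring
        have h8 : ε * a ^ 2 ≤ ε * l ^ n := by gcongr
        have h9 : 0 ≤ a * ‖g x‖ := by positivity
        linarith
      rw [norm_smul, norm_smul, h1, Set.indicator_of_mem hx, Set.indicator_of_mem hx]
      calc l ^ n * (l ^ k)⁻¹ * (‖φ (l • x)‖ * ‖g x‖)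
          = ‖φ (l • x)‖ * (l ^ n * (l ^ k)⁻¹ * ‖g x‖) := by ring
        _ ≤ M * (ε * l ^ n + ε⁻¹ * ‖g x‖ ^ 2) := by
          gcongr
          exact hM _
    · have h1 : φ (l • x) = 0 := image_eq_zero_of_notMem_tsupport fun h => hx <| by
        have := hφr h
        simpa [A, norm_smul, abs_of_pos hl0, lt_div_iff₀' hl0] using this
      simp [h1, hx]
  have hlim : Filter.Tendsto (fun m : ℕ => ∫ x in (unitBall n : Set (Euc n)),
      (A m).indicator (fun x => ‖g x‖ ^ 2) x) Filter.atTop (𝓝 0) := by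
    rw [← integral_zero (Euc n) ℝ (μ := volume.restrict (unitBall n : Set (Euc n)))]
    refine tendsto_integral_of_dominated_convergence (fun x => ‖g x‖ ^ 2)
      (fun m => (hg2.indicator (hA m)).aestronglyMeasurable) hg2
      (fun m => .of_forall fun x => ?_) ?_
    · refine (norm_indicator_le_norm_self _ _).trans ?_
      rw [Real.norm_of_nonneg (by positivity)]
    · filter_upwards [ae_mem_puncturedBall hn] with x hx
      have hx0 : 0 < ‖x‖ := norm_pos_iff.mpr (mem_puncturedBall.mp hx).2
      refine tendsto_const_nhds.congr' ?_
      filter_upwards [tendsto_natCast_atTop_atTop.eventually_gt_atTop (r / ‖x‖)] with m hm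
      refine (Set.indicator_of_notMem (fun h => ?_) _).symm
      have h1 : ‖x‖ < r / m := by simpa [A] using h
      have h2 : (0 : ℝ) < m := (by positivity : 0 < r / ‖x‖).trans hm
      rw [lt_div_iff₀ h2] at h1
      rw [div_lt_iff₀ hx0] at hm
      linarith [mul_comm ‖x‖ (m : ℝ)]
  -- First `l → ∞` with `ε` fixed, which removes the `ε⁻¹` term; then `ε → 0`.
  have hε (ε : ℝ) (hε : 0 < ε) :
      ‖T‖ ≤ M * (ε * (r ^ n * volume.real (Metric.ball (0 : Euc n) 1))) := by
    have h1 := ((hlim.const_mul ε⁻¹).const_add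
      (ε * (r ^ n * volume.real (Metric.ball (0 : Euc n) 1)))).const_mul M
    rw [mul_zero, add_zero] at h1
    refine ge_of_tendsto h1 ?_
    filter_upwards [Filter.eventually_ge_atTop 1,
      tendsto_natCast_atTop_atTop.eventually_gt_atTop r] with m hm1 hm2
    exact hest ε hε hm2 (by exact_mod_cast hm1)
  rw [← norm_le_zero_iff]
  have h1 : Filter.Tendsto
      (fun ε : ℝ => M * (ε * (r ^ n * volume.real (Metric.ball (0 : Euc n) 1))))
      (𝓝[>] 0) (𝓝 0) := by
    have : Continuous fun ε : ℝ =>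
      M * (ε * (r ^ n * volume.real (Metric.ball (0 : Euc n) 1))) := by fun_prop
    simpa using (this.tendsto 0).mono_left nhdsWithin_le_nhds
  refine ge_of_tendsto h1 ?_
  filter_upwards [self_mem_nhdsWithin] with ε h using hε ε h

theorem not_memSobolev_equatorMap (hn : 0 < n) (hk0 : 0 < k) (hk : n ≤ 2 * k) :
    ¬MemSobolev (unitBall n) k (equatorMap n) := by
  intro h
  let i : Fin n := ⟨0, hn⟩
  obtain ⟨g, hw, hg⟩ := h.2 k le_rfl fun _ => i
  obtain ⟨l, rfl⟩ : ∃ l, k = l + 1 := ⟨k - 1, by omega⟩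
  obtain ⟨φ, hφ, y, hy⟩ := exists_equatorConv_dirDeriv_iterate_ne_zero
    (e := stdVec i) (by simp) l
  -- The test function `x ↦ φ(y - x)` turns the integral into the convolution at `y`, up to the sign
  -- `(-1)^k`.
  have h1 := integral_dirDeriv_iterate_smul_equatorMap_eq_zero hn hk hw hg
    (hφ.comp_affine y (c := -1) (by norm_num))
  rw [dirDeriv_iterate_comp_affine hφ _ _ (by norm_num)] at h1
  simp only [mul_smul, neg_smul, one_smul, ← sub_eq_add_neg] at h1
  rw [integral_smul, smul_eq_zero] at h1
  exact hy (h1.resolve_left (by simp))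

end Scaling

end EquatorMap

end

theorem proposition1p1 (n k : ℕ) (hn : 1 ≤ n) (hk : 1 ≤ k) :
    (EquatorMap.MemSobolevSphere n k (EquatorMap.equatorMap n) ↔ 2 * k + 1 ≤ n) ∧
    (2 * k + 1 ≤ n → EquatorMap.IsExtrinsicHarmonic n k (EquatorMap.equatorMap n)) := by
  refine ⟨⟨fun h => ?_, EquatorMap.memSobolevSphere_equatorMap⟩,
    EquatorMap.isExtrinsicHarmonic_equatorMap⟩
  by_contra hnk
  exact EquatorMap.not_memSobolev_equatorMap hn hk (by omega) h.1
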